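/- **Theorem 1.4.** Let $\Phi$ be a (reduced, crystallographic) root system in a Euclidean plane $E$. For $\alpha\in\Phi$, $k\in\mathbb Z$ let $H_{\alpha,k}=\{x\in E\mid\langle x,\alpha\rangle=k\}$ and let $s_{\alpha;k}(x)=x-(\langle x,\alpha\rangle-k)\alpha^\vee$, where $\alpha^\vee=2\alpha/\langle\alpha,\alpha\rangle$, be the reflection in $H_{\alpha,k}$. Let $W$ be the affine Weyl group generated by all $s_{\alpha;k}$. The alcoves are the connected components of the complement of $\bigcup_{\alpha,k}H_{\alpha,k}$; fix one of them, $C$, let $S=\{s_i\}_{i\in I}\subset W$ be the set of reflections in the hyperplanes containing a codimension-one face of $C$, let $\ell$ be the word length on $W$ with respect to $S$, and identify $w\in W$ with the alcove $wC$, so that $1$ is identified with $C$. For a reflection $r\in W$ let $H_r$ denote its hyperplane of fixed points. Two hyperplanes $H_r,H_{r'}$ are *adjacent parallel* if they are parallel and distinct and no hyperplane of the arrangement parallel to them lies strictly between them. The *shadow* $\mathrm{Sh}(y)$ of $y\in W$ is the set of all $x\in W$ that are the last alcove of a gallery obtained by folding (at any set of panels) a minimal gallery from $1$ to $y$; it is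 the lower interval $[1,y]$ of the Bruhat order. The *annex* of $w\in W$ is $\mathrm{Annex}(w)=\{y\in W\mid w\notin\mathrm{Sh}(y)\}$, i.e. the set of all $y\in W$ with $w\not\le y$ in the Bruhat order. Let $w\in W$ and $s_i\in S$ with $\ell(ws_i)<\ell(w)$. Let $n\ge1$ and let $r_1,\dots,r_n\in W$ be reflections such that $H_{r_t}$ and $H_{r_{t+1}}$ are adjacent parallel for all $1\le t<n$, and such that for all $1\le t\le n$ $$\ell(r_t\cdots r_1ws_i)=\ell(r_{t-1}\cdots r_1ws_i)+1\quad\text{and}\quad r_t\cdots r_1ws_i\ne r_{t-1}\cdots r_1w .$$ Suppose that no hyperplane of the arrangement parallel to $H_{r_1}$ lies strictly between the alcove $w$ and $H_{r_1}$. Then $$r_n\cdots r_1ws_i\in\mathrm{Annex}(w).$$ -/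

import Mathlib

noncomputable section

namespace AffineCoxeter

/-! ### Galleries, foldings and annexes in a group `G` with generating set `S`

Alcoves are identified with the elements of `G`; the alcoves adjacent to `x` are the `x * s` with
`s ∈ S`, and the reflection in the wall between `x` and `x * s` is `x * s * x⁻¹`. -/

section Gallery

variable {G : Type*} [Group G]

/-- The length of `w` with respect to `S`: the least length of a word in `S` with product `w`. -/
def length (S : Set G) (w : G) : ℕ :=
  sInf {n | ∃ l : List G, (∀ s ∈ l, s ∈ S) ∧ l.length = n ∧ l.prod = w}

/-- `IsGallery S c₀ [(j₁, c₁), …, (jₙ, cₙ)]`: the sequence `(c₀, p₁, c₁, …, pₙ, cₙ)`, where `pₘ` is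
the panel of type `jₘ` of the alcove `cₘ₋₁`, is a (possibly folded) gallery, that is,
each `cₘ` contains `pₘ`. The gallery is folded at `pₘ` if `cₘ = cₘ₋₁`. -/
def IsGallery (S : Set G) : G → List (G × G) → Prop
  | _, [] => True
  | c, (s, d) :: γ => s ∈ S ∧ (d = c ∨ d = c * s) ∧ IsGallery S d γ

/-- The last alcove of a gallery starting in `c`. -/
def lastAlcove : G → List (G × G) → G
  | c, [] => c
  | _, (_, d) :: γ => lastAlcove d γ

/-- The (un)folding of a gallery starting in `c` at its panel number `i` (counted from `0`): the
alcoves after that panel are reflected in the wall that contains the panel. -/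
def fold : G → List (G × G) → ℕ → List (G × G)
  | _, [], _ => []
  | c, (s, d) :: γ, 0 => ((s, d) :: γ).map fun p => (p.1, (c * s * c⁻¹) * p.2)
  | _, (s, d) :: γ, i + 1 => (s, d) :: fold d γ i

/-- A minimal gallery from `c` to `d`. -/
def IsMinimalGallery (S : Set G) (c d : G) (γ : List (G × G)) : Prop :=
  IsGallery S c γ ∧ lastAlcove c γ = d ∧
    ∀ γ', IsGallery S c γ' → lastAlcove c γ' = d → γ.length ≤ γ'.length

/-- The (trivial) shadow of `w`: the last alcoves of the multifoldings of a minimal gallery from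
the identity alcove to `w`. -/
def shadow (S : Set G) (w : G) : Set G :=
  {x | ∃ γ, IsMinimalGallery S 1 w γ ∧ ∃ I : List ℕ, lastAlcove 1 (I.foldl (fold 1) γ) = x}

/-- The annex of `x`: the alcoves in whose shadow `x` does not lie. -/
def annex (S : Set G) (x : G) : Set G :=
  {y | x ∉ shadow S y}

/-- The product `r_t ⋯ r_2 r_1`. -/
def revProd (r : ℕ → G) : ℕ → G
  | 0 => 1
  | t + 1 => r (t + 1) * revProd r t

end Gallery

/-! ### Affine Weyl groups and their alcoves -/

section Geometry

variable {E : Type*} [NormedAddCommGroup E] [InnerProductSpace ℝ E]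

/-- A (reduced, crystallographic) root system in the Euclidean space `E`. -/
structure IsRootSystem (Φ : Set E) : Prop where
  finite : Φ.Finite
  span_eq_top : Submodule.span ℝ Φ = ⊤
  zero_notMem : (0 : E) ∉ Φ
  reduced : ∀ α ∈ Φ, ∀ c : ℝ, c • α ∈ Φ → c = 1 ∨ c = -1
  reflection_mem : ∀ α ∈ Φ, ∀ β ∈ Φ, β - (2 * inner ℝ β α / inner ℝ α α) • α ∈ Φ
  integral : ∀ α ∈ Φ, ∀ β ∈ Φ, ∃ m : ℤ, 2 * inner ℝ β α / inner ℝ α α = m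

/-- The coroot `2 α / ⟨α, α⟩`. -/
def coroot (α : E) : E := (2 / inner ℝ α α : ℝ) • α

theorem affineReflection_involutive (α : E) (k : ℝ) :
    Function.Involutive fun x : E => x - (inner ℝ x α - k) • coroot α := by
  intro x
  rcases eq_or_ne α 0 with rfl | h
  · simp [coroot]
  · have h2 : inner ℝ (coroot α) α = 2 := by
      have : (inner ℝ α α : ℝ) ≠ 0 := inner_self_ne_zero.mpr h
      simp only [coroot, real_inner_smul_left]
      field_simp
    simp only [inner_sub_left, real_inner_smul_left, h2]
    module

/-- The reflection `s_{α;k}(x) = x - (⟨x, α⟩ - k) α^∨`. -/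
def affineReflection (α : E) (k : ℝ) : Equiv.Perm E :=
  (affineReflection_involutive α k).toPerm

/-- The affine Weyl group, generated by the reflections `s_{α;k}` with `α ∈ Φ`, `k ∈ ℤ`. -/
def affineWeylGroup (Φ : Set E) : Subgroup (Equiv.Perm E) :=
  Subgroup.closure {g | ∃ α ∈ Φ, ∃ k : ℤ, g = affineReflection α k}

/-- The reflections in the affine Weyl group. -/
def IsReflection (Φ : Set E) (r : affineWeylGroup Φ) : Prop :=
  ∃ α ∈ Φ, ∃ k : ℤ, (r : Equiv.Perm E) = affineReflection α k

/-- The wall `H_r` of a reflection `r`, i.e. the hyperplane of the points fixed by `r`. -/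
def wall (Φ : Set E) (r : affineWeylGroup Φ) : AffineSubspace ℝ E :=
  affineSpan ℝ {x | (r : Equiv.Perm E) x = x}

/-- The complement of the union of all hyperplanes `H_{α,k}`. -/
def regularPoints (Φ : Set E) : Set E :=
  {x | ∀ α ∈ Φ, ∀ k : ℤ, inner ℝ x α ≠ (k : ℝ)}

/-- An (open) alcove: a connected component of the complement of the hyperplanes. -/
def IsAlcove (Φ : Set E) (C : Set E) : Prop :=
  ∃ x ∈ regularPoints Φ, C = connectedComponentIn (regularPoints Φ) x

/-- The simple reflections with respect to the alcove `C`: the reflections in the hyperplanes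
that contain a panel (codimension one face) of `C`. -/
def simpleReflections (Φ : Set E) (C : Set E) : Set (affineWeylGroup Φ) :=
  {s | IsReflection Φ s ∧ affineSpan ℝ (closure C ∩ (wall Φ s : Set E)) = wall Φ s}

/-- The hyperplane `H_q` lies (strictly) between the sets `A` and `B` of points. -/
def WallBetween (Φ : Set E) (q : affineWeylGroup Φ) (A B : Set E) : Prop :=
  ∀ x ∈ A, ∀ y ∈ B, (wall Φ q).SOppSide x y

/-- The hyperplanes `H_r` and `H_r'` are parallel and adjacent: they are distinct, and no
hyperplane of the complex parallel to them lies between them. -/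
def AdjacentParallel (Φ : Set E) (r r' : affineWeylGroup Φ) : Prop :=
  (wall Φ r).Parallel (wall Φ r') ∧ wall Φ r ≠ wall Φ r' ∧
    ∀ q : affineWeylGroup Φ, IsReflection Φ q → (wall Φ q).Parallel (wall Φ r) →
      ¬ WallBetween Φ q (wall Φ r) (wall Φ r')

end Geometry

end AffineCoxeter

end

noncomputable section

namespace AffineCoxeter

section RootSystem

variable {E : Type*} [NormedAddCommGroup E] [InnerProductSpace ℝ E] {Φ : Set E}

/-! ### Reflections -/

theorem affineReflection_apply (α : E) (k : ℝ) (x : E) :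
    affineReflection α k x = x - (inner ℝ x α - k) • coroot α := rfl

theorem affineReflection_affineReflection (α : E) (k : ℝ) (x : E) :
    affineReflection α k (affineReflection α k x) = x :=
  affineReflection_involutive α k x

theorem inner_coroot_right (β α : E) :
    inner ℝ β (coroot α) = 2 * inner ℝ β α / inner ℝ α α := by
  rw [coroot, real_inner_smul_right]; ring

theorem inner_self_coroot {α : E} (h : α ≠ 0) : inner ℝ α (coroot α) = 2 := by
  have : (inner ℝ α α : ℝ) ≠ 0 := inner_self_ne_zero.mpr h
  rw [inner_coroot_right]; field_simp

theorem coroot_neg (α : E) : coroot (-α) = -coroot α := by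
  simp [coroot]

theorem affineReflection_neg (α : E) (k : ℝ) :
    affineReflection (-α) (-k) = affineReflection α k := by
  ext x
  simp only [affineReflection_apply, coroot_neg, inner_neg_right]
  module

/-- The linear reflection in the hyperplane orthogonal to `α`. -/
def linearReflection (α : E) : E ≃ₗᵢ[ℝ] E := (ℝ ∙ α)ᗮ.reflection

theorem linearReflection_apply (α v : E) :
    linearReflection α v = v - (inner ℝ v α : ℝ) • coroot α := by
  rw [linearReflection, Submodule.reflection_orthogonal_apply,
    Submodule.reflection_singleton_apply, coroot, real_inner_self_eq_norm_sq, real_inner_comm v α]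
  simp only [RCLike.ofReal_real_eq_id, id, smul_smul, neg_sub]
  rw [two_nsmul, ← add_smul]
  congr 2
  ring

theorem linearReflection_apply' (α v : E) :
    linearReflection α v = v - (inner ℝ v (coroot α) : ℝ) • α := by
  rw [linearReflection_apply, inner_coroot_right, coroot, smul_smul]
  congr 2
  ring

theorem linearReflection_linearReflection (α v : E) :
    linearReflection α (linearReflection α v) = v := by
  simp [linearReflection]

theorem linearReflection_self (α : E) : linearReflection α α = -α := by
  rw [linearReflection]
  exact Submodule.reflection_orthogonalComplement_singleton_eq_neg α

theorem inner_linearReflection (α x y : E) :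
    inner ℝ (linearReflection α x) y = inner ℝ x (linearReflection α y) := by
  conv_lhs => rw [← linearReflection_linearReflection α y]
  exact LinearIsometryEquiv.inner_map_map _ _ _

theorem inner_affineReflection (γ : E) (j : ℝ) (p δ : E) :
    inner ℝ (affineReflection γ j p) δ
      = inner ℝ p (linearReflection γ δ) + j * inner ℝ (coroot γ) δ := by
  rw [← inner_linearReflection, affineReflection_apply, linearReflection_apply]
  simp only [inner_sub_left, real_inner_smul_left]
  ring

theorem coroot_map (L : E ≃ₗᵢ[ℝ] E) (α : E) : coroot (L α) = L (coroot α) := by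
  simp [coroot]

namespace IsRootSystem

theorem ne_zero (hΦ : IsRootSystem Φ) {α : E} (h : α ∈ Φ) : α ≠ 0 := fun h0 => hΦ.zero_notMem (h0 ▸ h)

theorem linearReflection_mem (hΦ : IsRootSystem Φ) {α β : E} (hα : α ∈ Φ) (hβ : β ∈ Φ) :
    linearReflection α β ∈ Φ := by
  rw [linearReflection_apply', inner_coroot_right]
  exact hΦ.reflection_mem α hα β hβ

theorem neg_mem (hΦ : IsRootSystem Φ) {α : E} (hα : α ∈ Φ) : -α ∈ Φ := by
  rw [← linearReflection_self]
  exact hΦ.linearReflection_mem hα hα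

theorem exists_inner_coroot (hΦ : IsRootSystem Φ)
    {α β : E} (hα : α ∈ Φ) (hβ : β ∈ Φ) :
    ∃ m : ℤ, inner ℝ β (coroot α) = (m : ℝ) := by
  rw [inner_coroot_right]
  exact hΦ.integral α hα β hβ

end IsRootSystem

/-! ### Elements of the affine Weyl group -/

/-- The reflection `s_{α;k}` as an element of the affine Weyl group. -/
def mkReflection {α : E} (hα : α ∈ Φ) (k : ℤ) : affineWeylGroup Φ :=
  ⟨affineReflection α k, Subgroup.subset_closure ⟨α, hα, k, rfl⟩⟩

theorem coe_mkReflection {α : E} (hα : α ∈ Φ) (k : ℤ) :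
    (mkReflection hα k : Equiv.Perm E) = affineReflection α k := rfl

theorem isReflection_iff {r : affineWeylGroup Φ} :
    IsReflection Φ r ↔ ∃ (α : E) (hα : α ∈ Φ) (k : ℤ), r = mkReflection hα k := by
  constructor
  · rintro ⟨α, hα, k, h⟩
    exact ⟨α, hα, k, Subtype.ext h⟩
  · rintro ⟨α, hα, k, rfl⟩
    exact ⟨α, hα, k, rfl⟩

theorem mkReflection_mul_self {α : E} (hα : α ∈ Φ) (k : ℤ) :
    mkReflection hα k * mkReflection hα k = 1 := by
  apply Subtype.ext
  ext x
  exact affineReflection_affineReflection α k x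

theorem mkReflection_inv {α : E} (hα : α ∈ Φ) (k : ℤ) :
    (mkReflection hα k)⁻¹ = mkReflection hα k :=
  inv_eq_of_mul_eq_one_left (mkReflection_mul_self hα k)

theorem mkReflection_neg (hΦ : IsRootSystem Φ) {α : E} (hα : α ∈ Φ) (k : ℤ) :
    mkReflection (hΦ.neg_mem hα) (-k) = mkReflection hα k := by
  apply Subtype.ext
  rw [coe_mkReflection, coe_mkReflection, ← affineReflection_neg α k]
  push_cast
  rfl

theorem exists_linearPart (hΦ : IsRootSystem Φ) (g : affineWeylGroup Φ) :
    ∃ L : E ≃ₗᵢ[ℝ] E, (∀ δ ∈ Φ, L δ ∈ Φ) ∧ (∀ δ ∈ Φ, L.symm δ ∈ Φ) ∧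
      (∀ p, (g : Equiv.Perm E) p = L p + (g : Equiv.Perm E) 0) ∧
      ∀ δ ∈ Φ, ∃ m : ℤ, inner ℝ ((g : Equiv.Perm E) 0) δ = (m : ℝ) := by
  obtain ⟨g, hg⟩ := g
  simp only
  induction hg using Subgroup.closure_induction with
  | mem x hx =>
    obtain ⟨α, hα, k, rfl⟩ := hx
    refine ⟨linearReflection α, fun δ hδ => hΦ.linearReflection_mem hα hδ, fun δ hδ => ?_,
      fun p => ?_, fun δ hδ => ?_⟩
    · have : (linearReflection α).symm δ = linearReflection α δ := by
        rw [LinearIsometryEquiv.symm_apply_eq, linearReflection_linearReflection]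
      rw [this]
      exact hΦ.linearReflection_mem hα hδ
    · simp only [affineReflection_apply, linearReflection_apply, inner_zero_left]
      module
    · obtain ⟨m, hm⟩ := hΦ.exists_inner_coroot hα hδ
      refine ⟨k * m, ?_⟩
      rw [inner_affineReflection, inner_zero_left, real_inner_comm, hm]
      push_cast; ring
  | one => exact ⟨.refl ℝ E, fun _ h => h, fun _ h => h, by simp, fun δ _ => ⟨0, by simp⟩⟩
  | mul x y _ _ hx hy =>
    obtain ⟨L, h1, h2, h3, h4⟩ := hx
    obtain ⟨M, k1, k2, k3, k4⟩ := hy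
    refine ⟨M.trans L, fun δ hδ => h1 _ (k1 _ hδ), fun δ hδ => k2 _ (h2 _ hδ), fun p => ?_,
      fun δ hδ => ?_⟩
    · rw [Equiv.Perm.mul_apply, Equiv.Perm.mul_apply, h3 (y p), h3 (y 0), k3 p]
      simp [add_assoc]
    · obtain ⟨m, hm⟩ := h4 δ hδ
      obtain ⟨n, hn⟩ := k4 _ (h2 _ hδ)
      refine ⟨n + m, ?_⟩
      rw [Equiv.Perm.mul_apply, h3 (y 0), inner_add_left, hm]
      push_cast
      rw [← hn, ← LinearIsometryEquiv.inner_map_map L (y 0) (L.symm δ)]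
      simp
  | inv x _ hx =>
    obtain ⟨L, h1, h2, h3, h4⟩ := hx
    have key : ∀ p, x⁻¹ p = L.symm (p - x 0) := by
      intro p
      rw [Equiv.Perm.inv_eq_iff_eq, h3]
      simp
    refine ⟨L.symm, h2, by simpa using h1, fun p => ?_, fun δ hδ => ?_⟩
    · rw [key, key]
      simp [sub_eq_add_neg]
    · obtain ⟨m, hm⟩ := h4 _ (h1 _ hδ)
      refine ⟨-m, ?_⟩
      rw [key, ← LinearIsometryEquiv.inner_map_map L]
      simp [hm]

/-! ### Levels and separating hyperplanes -/

/-- The number of the strip between hyperplanes orthogonal to `δ` in which `p` lies. -/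
def level (δ p : E) : ℤ := ⌊(inner ℝ p δ : ℝ)⌋

/-- The hyperplane `H_{γ,k}` separates `p` and `q`. -/
def Separates (γ : E) (k : ℤ) (p q : E) : Prop :=
  level γ p < k ∧ k ≤ level γ q ∨ level γ q < k ∧ k ≤ level γ p

theorem Separates.symm {γ : E} {k : ℤ} {p q : E} (h : Separates γ k p q) :
    Separates γ k q p := Or.symm h

theorem separates_trans_iff {γ : E} {k : ℤ} {p q r : E} (h : ¬ Separates γ k p q) :
    Separates γ k p r ↔ Separates γ k q r := by
  unfold Separates at *; omega

theorem lt_level_iff {p : E} (hp : p ∈ regularPoints Φ) {δ : E} (hδ : δ ∈ Φ) (k : ℤ) :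
    k ≤ level δ p ↔ (k : ℝ) < inner ℝ p δ := by
  rw [level, Int.le_floor]
  exact ⟨fun h => lt_of_le_of_ne h (hp δ hδ k).symm, le_of_lt⟩

theorem level_lt_iff {p δ : E} (k : ℤ) : level δ p < k ↔ (inner ℝ p δ : ℝ) < k := by
  rw [level, Int.floor_lt]

theorem level_le_inner (p δ : E) : (level δ p : ℝ) ≤ inner ℝ p δ := Int.floor_le _

theorem inner_lt_level (p δ : E) : (inner ℝ p δ : ℝ) < level δ p + 1 := Int.lt_floor_add_one _

theorem level_neg {p : E} (hp : p ∈ regularPoints Φ) {δ : E} (hδ : δ ∈ Φ) :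
    level (-δ) p = -level δ p - 1 := by
  have h1 := (lt_level_iff hp hδ _).1 (le_refl (level δ p))
  have h2 := inner_lt_level p δ
  rw [level, Int.floor_eq_iff, inner_neg_right]
  push_cast
  constructor <;> linarith

theorem exists_level_smul (hΦ : IsRootSystem Φ) (g : affineWeylGroup Φ) :
    ∃ L : E ≃ₗᵢ[ℝ] E, (∀ δ ∈ Φ, L δ ∈ Φ) ∧ (∀ δ ∈ Φ, L.symm δ ∈ Φ) ∧
      (∀ p, (g : Equiv.Perm E) p = L p + (g : Equiv.Perm E) 0) ∧
      ∀ δ ∈ Φ, ∃ m : ℤ, (∀ p, (inner ℝ ((g : Equiv.Perm E) p) δ : ℝ) = inner ℝ p (L.symm δ) + m) ∧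
        ∀ p, level δ ((g : Equiv.Perm E) p) = level (L.symm δ) p + m := by
  obtain ⟨L, h1, h2, h3, h4⟩ := exists_linearPart hΦ g
  refine ⟨L, h1, h2, h3, fun δ hδ => ?_⟩
  obtain ⟨m, hm⟩ := h4 δ hδ
  have key : ∀ p, (inner ℝ ((g : Equiv.Perm E) p) δ : ℝ) = inner ℝ p (L.symm δ) + m := by
    intro p
    rw [h3, inner_add_left, hm, ← LinearIsometryEquiv.inner_map_map L p (L.symm δ)]
    simp
  refine ⟨m, key, fun p => ?_⟩
  rw [level, key, Int.floor_add_intCast, level]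

theorem smul_mem_regularPoints (hΦ : IsRootSystem Φ) (g : affineWeylGroup Φ) {p : E}
    (hp : p ∈ regularPoints Φ) : (g : Equiv.Perm E) p ∈ regularPoints Φ := by
  obtain ⟨L, -, h2, -, h4⟩ := exists_level_smul hΦ g
  intro δ hδ k
  obtain ⟨m, hm, -⟩ := h4 δ hδ
  rw [hm]
  have := hp _ (h2 δ hδ) (k - m)
  push_cast at this
  intro h
  exact this (by linarith)

theorem exists_conj_mkReflection (hΦ : IsRootSystem Φ) (g : affineWeylGroup Φ) {γ : E}
    (hγ : γ ∈ Φ) (j : ℤ) :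
    ∃ (γ' : E) (hγ' : γ' ∈ Φ) (j' : ℤ), g * mkReflection hγ j * g⁻¹ = mkReflection hγ' j' ∧
      ∀ p q, Separates γ' j' ((g : Equiv.Perm E) p) ((g : Equiv.Perm E) q) ↔
        Separates γ j p q := by
  obtain ⟨L, h1, h2, h3, h4⟩ := exists_level_smul hΦ g
  obtain ⟨m, hm, hm'⟩ := h4 _ (h1 γ hγ)
  refine ⟨L γ, h1 γ hγ, j + m, ?_, fun p q => ?_⟩
  · rw [mul_inv_eq_iff_eq_mul]
    apply Subtype.ext
    ext y
    simp only [Subgroup.coe_mul, Equiv.Perm.mul_apply, coe_mkReflection, affineReflection_apply,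
      coroot_map, hm, LinearIsometryEquiv.symm_apply_apply]
    rw [h3, h3 y, map_sub, map_smul]
    push_cast
    module
  · unfold Separates
    simp only [hm', LinearIsometryEquiv.symm_apply_apply]
    omega

/-! ### The number of separating hyperplanes -/

/-- Twice the number of hyperplanes that separate `p` and `q`. -/
def wallDist (hΦ : IsRootSystem Φ) (p q : E) : ℤ :=
  ∑ δ ∈ hΦ.finite.toFinset, |level δ p - level δ q|

theorem wallDist_smul (hΦ : IsRootSystem Φ) (g : affineWeylGroup Φ) (p q : E) :
    wallDist hΦ ((g : Equiv.Perm E) p) ((g : Equiv.Perm E) q) = wallDist hΦ p q := by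
  obtain ⟨L, h1, h2, h3, h4⟩ := exists_level_smul hΦ g
  unfold wallDist
  refine Finset.sum_nbij' (fun δ => L.symm δ) (fun δ => L δ) ?_ ?_ ?_ ?_ ?_
  · simpa using h2
  · simpa using h1
  · simp
  · simp
  · intro δ hδ
    obtain ⟨m, -, hm⟩ := h4 δ (by simpa using hδ)
    rw [hm, hm, add_sub_add_right_eq_sub]

theorem wallDist_triangle (hΦ : IsRootSystem Φ) (p q r : E) :
    wallDist hΦ p r ≤ wallDist hΦ p q + wallDist hΦ q r := by
  unfold wallDist
  rw [← Finset.sum_add_distrib]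
  exact Finset.sum_le_sum fun δ _ => abs_sub_le _ _ _

theorem wallDist_self (hΦ : IsRootSystem Φ) (p : E) : wallDist hΦ p p = 0 := by
  simp [wallDist]

/-! ### Reflecting away from a base point -/

theorem level_mkReflection {α β : E} (a : ℤ) (p : E) {c : ℤ}
    (hc : (inner ℝ β (coroot α) : ℝ) = c) :
    level β (affineReflection α a p) = level (linearReflection α β) p + a * c := by
  rw [level, inner_affineReflection, real_inner_comm β, hc]
  have : (a : ℝ) * (c : ℝ) = ((a * c : ℤ) : ℝ) := by push_cast; ring
  rw [this, Int.floor_add_intCast, level]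

theorem level_self_mkReflection (hΦ : IsRootSystem Φ) {α : E} (hα : α ∈ Φ) (a : ℤ) {p : E}
    (hp : p ∈ regularPoints Φ) :
    level α (affineReflection α a p) = 2 * a - 1 - level α p := by
  have h : (inner ℝ α (coroot α) : ℝ) = ((2 : ℤ) : ℝ) := by
    rw [inner_self_coroot (hΦ.ne_zero hα)]; norm_num
  rw [level_mkReflection a p h, linearReflection_self, level_neg hp hα]
  ring

/-- The contribution to the wall distance of the hyperplanes orthogonal to `β` or to its mirror
image in `α`. -/
def pairDist (α β p q : E) : ℤ :=
  |level β p - level β q| + |level (linearReflection α β) p - level (linearReflection α β) q|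

theorem sum_pairDist (hΦ : IsRootSystem Φ) {α : E} (hα : α ∈ Φ) (p q : E) :
    ∑ β ∈ hΦ.finite.toFinset, pairDist α β p q = 2 * wallDist hΦ p q := by
  unfold pairDist
  rw [Finset.sum_add_distrib, two_mul]
  congr 1
  refine Finset.sum_nbij' (fun δ => linearReflection α δ) (fun δ => linearReflection α δ)
    ?_ ?_ ?_ ?_ ?_
  · intro δ hδ
    simpa using hΦ.linearReflection_mem hα (by simpa using hδ)
  · intro δ hδ
    simpa using hΦ.linearReflection_mem hα (by simpa using hδ)
  · intro δ _; exact linearReflection_linearReflection α δ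
  · intro δ _; exact linearReflection_linearReflection α δ
  · intro δ _; rfl

theorem level_linearReflection_le {α β : E} {c : ℤ} (hc : (inner ℝ β (coroot α) : ℝ) = c)
    (hc0 : c ≤ 0) {a : ℤ} {p : E} (h : level α p < a) :
    level (linearReflection α β) p ≤ level β p - c * a := by
  have h1 : (inner ℝ p (linearReflection α β) : ℝ) ≤ inner ℝ p β + ((-(c * a) : ℤ) : ℝ) := by
    rw [linearReflection_apply', inner_sub_right, real_inner_smul_right, hc]
    have h2 := (level_lt_iff a).1 h
    have h3 : (c : ℝ) ≤ 0 := by exact_mod_cast hc0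
    push_cast
    nlinarith
  have := Int.floor_le_floor h1
  rw [Int.floor_add_intCast] at this
  unfold level
  linarith

theorem le_level_linearReflection {α β : E} {c : ℤ} (hc : (inner ℝ β (coroot α) : ℝ) = c)
    (hc0 : 0 ≤ c) {a : ℤ} {p : E} (h : level α p < a) :
    level β p - c * a ≤ level (linearReflection α β) p := by
  have h1 : inner ℝ p β + ((-(c * a) : ℤ) : ℝ) ≤ (inner ℝ p (linearReflection α β) : ℝ) := by
    rw [linearReflection_apply', inner_sub_right, real_inner_smul_right, hc]
    have h2 := (level_lt_iff a).1 h
    have h3 : (0 : ℝ) ≤ c := by exact_mod_cast hc0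
    push_cast
    nlinarith
  have := Int.floor_le_floor h1
  rw [Int.floor_add_intCast] at this
  unfold level
  linarith

theorem abs_rearrange_of_le {x y u v : ℤ} (h : (y ≤ x ∧ v ≤ u) ∨ (x ≤ y ∧ u ≤ v)) :
    |x - u| + |y - v| ≤ |y - u| + |x - v| := by
  simp only [abs_eq_max_neg]
  omega

theorem pairDist_le_of_lt (hΦ : IsRootSystem Φ) {α β : E} (hα : α ∈ Φ) (hβ : β ∈ Φ) {a : ℤ} {p q : E}
    (hp : level α p < a) (hq : level α q < a) :
    pairDist α β p q ≤ pairDist α β (affineReflection α a p) q := by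
  obtain ⟨c, hc⟩ := hΦ.exists_inner_coroot hα hβ
  have hc' : (inner ℝ (linearReflection α β) (coroot α) : ℝ) = ((-c : ℤ) : ℝ) := by
    rw [inner_linearReflection, coroot, map_smul, linearReflection_self, smul_neg,
      inner_neg_right, ← coroot, hc]
    push_cast; rfl
  unfold pairDist
  rw [level_mkReflection a p hc, level_mkReflection a p hc',
    linearReflection_linearReflection]
  have key := abs_rearrange_of_le (x := level β p) (u := level β q)
    (y := level (linearReflection α β) p + a * c) (v := level (linearReflection α β) q + a * c) (by
      rcases le_total c 0 with h | h
      · left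
        have h1 := level_linearReflection_le hc h hp
        have h2 := level_linearReflection_le hc h hq
        constructor <;> linarith
      · right
        have h1 := le_level_linearReflection hc h hp
        have h2 := le_level_linearReflection hc h hq
        constructor <;> linarith)
  calc _ = |level β p - level β q| +
        |level (linearReflection α β) p + a * c - (level (linearReflection α β) q + a * c)| := by
        congr 2; ring
    _ ≤ _ := key
    _ = _ := by congr 2; ring

theorem abs_level_lt_of_lt (hΦ : IsRootSystem Φ) {α : E} (hα : α ∈ Φ) {a : ℤ} {p q : E} (hpr : p ∈ regularPoints Φ)
    (hp : level α p < a) (hq : level α q < a) :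
    |level α p - level α q| + 1 ≤ |level α (affineReflection α a p) - level α q| := by
  rw [level_self_mkReflection hΦ hα a hpr]
  simp only [abs_eq_max_neg]
  omega

theorem not_separates_cases {α : E} (hα : α ∈ Φ) {a : ℤ} {p q : E} (hp : p ∈ regularPoints Φ)
    (hq : q ∈ regularPoints Φ) (h : ¬ Separates α a p q) :
    (level α p < a ∧ level α q < a) ∨ (level (-α) p < -a ∧ level (-α) q < -a) := by
  unfold Separates at h
  rw [level_neg hp hα, level_neg hq hα]
  omega

theorem linearReflection_neg (α : E) : linearReflection (-α) = linearReflection α := by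
  ext x
  simp [linearReflection_apply, coroot_neg]

theorem pairDist_le (hΦ : IsRootSystem Φ) {α β : E} (hα : α ∈ Φ) (hβ : β ∈ Φ) {a : ℤ} {p q : E}
    (hp : p ∈ regularPoints Φ) (hq : q ∈ regularPoints Φ) (h : ¬ Separates α a p q) :
    pairDist α β p q ≤ pairDist α β (affineReflection α a p) q := by
  rcases not_separates_cases hα hp hq h with h | h
  · exact pairDist_le_of_lt hΦ hα hβ h.1 h.2
  · have := pairDist_le_of_lt hΦ (hΦ.neg_mem hα) hβ h.1 h.2
    unfold pairDist at *
    rw [linearReflection_neg] at this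
    rw [← affineReflection_neg α]
    exact_mod_cast this

theorem abs_level_lt (hΦ : IsRootSystem Φ) {α : E} (hα : α ∈ Φ) {a : ℤ} {p q : E}
    (hp : p ∈ regularPoints Φ) (hq : q ∈ regularPoints Φ) (h : ¬ Separates α a p q) :
    |level α p - level α q| + 1 ≤ |level α (affineReflection α a p) - level α q| := by
  rcases not_separates_cases hα hp hq h with h | h
  · exact abs_level_lt_of_lt hΦ hα hp h.1 h.2
  · have hr : affineReflection α a p ∈ regularPoints Φ :=
      smul_mem_regularPoints hΦ (mkReflection hα a) hp
    have := abs_level_lt_of_lt hΦ (hΦ.neg_mem hα) hp h.1 h.2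
    push_cast at this
    rw [affineReflection_neg α, level_neg hp hα, level_neg hq hα, level_neg hr hα] at this
    simp only [abs_eq_max_neg] at *
    omega

theorem pairDist_self {α : E} (hα : α ∈ Φ) {p q : E} (hp : p ∈ regularPoints Φ)
    (hq : q ∈ regularPoints Φ) : pairDist α α p q = 2 * |level α p - level α q| := by
  unfold pairDist
  rw [linearReflection_self, level_neg hp hα, level_neg hq hα]
  simp only [abs_eq_max_neg]
  omega

/-- Reflecting `p` away from `q` increases the wall distance. If it increases as little as
possible, then only one hyperplane, parallel to the mirror, contributes. -/
theorem wallDist_reflection (hΦ : IsRootSystem Φ) {α : E} (hα : α ∈ Φ) {a : ℤ} {p q : E}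
    (hp : p ∈ regularPoints Φ) (hq : q ∈ regularPoints Φ) (h : ¬ Separates α a p q) :
    wallDist hΦ p q + 2 ≤ wallDist hΦ (affineReflection α a p) q ∧
      (wallDist hΦ (affineReflection α a p) q = wallDist hΦ p q + 2 →
        |level α (affineReflection α a p) - level α q| = |level α p - level α q| + 1 ∧
        ∀ β ∈ Φ, β ≠ α → β ≠ -α →
          pairDist α β (affineReflection α a p) q = pairDist α β p q) := by
  classical
  set r := affineReflection α a p with hr
  have hrr : r ∈ regularPoints Φ := smul_mem_regularPoints hΦ (mkReflection hα a) hp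
  set F := hΦ.finite.toFinset with hF
  have hαF : α ∈ F := by simpa [hF] using hα
  have hne : -α ≠ α := by
    intro h0
    have h1 : (2 : ℝ) • α = 0 := by
      rw [two_smul]
      nth_rewrite 1 [← h0]
      exact neg_add_cancel α
    exact hΦ.ne_zero hα ((smul_eq_zero.1 h1).resolve_left two_ne_zero)
  have hnF : -α ∈ F.erase α := by
    simp only [Finset.mem_erase]
    exact ⟨hne, by simpa [hF] using hΦ.neg_mem hα⟩
  set f : E → ℤ := fun β => pairDist α β r q - pairDist α β p q with hf
  have hf0 : ∀ β ∈ F, 0 ≤ f β := fun β hβ =>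
    sub_nonneg.2 (pairDist_le hΦ hα (by simpa [hF] using hβ) hp hq h)
  have hsum : ∑ β ∈ F, f β = 2 * wallDist hΦ r q - 2 * wallDist hΦ p q := by
    rw [hf, Finset.sum_sub_distrib, sum_pairDist hΦ hα, sum_pairDist hΦ hα]
  have hsplit : ∑ β ∈ F, f β = f α + (f (-α) + ∑ β ∈ (F.erase α).erase (-α), f β) := by
    rw [← Finset.add_sum_erase _ _ hαF, ← Finset.add_sum_erase _ _ hnF]
  have habs := abs_level_lt hΦ hα hp hq h
  have h1 : f α = 2 * |level α r - level α q| - 2 * |level α p - level α q| := by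
    simp only [hf, pairDist_self hα hp hq, pairDist_self hα hrr hq]
  have h2 : f (-α) = f α := by
    simp only [hf, pairDist, map_neg, linearReflection_self, neg_neg]
    ring
  have h3 : ∀ β ∈ (F.erase α).erase (-α), 0 ≤ f β := fun β hβ =>
    hf0 β (Finset.mem_of_mem_erase (Finset.mem_of_mem_erase hβ))
  have h4 := Finset.sum_nonneg h3
  refine ⟨by linarith, fun heq => ?_⟩
  have h5 : ∑ β ∈ (F.erase α).erase (-α), f β = 0 := by linarith
  refine ⟨by linarith, fun β hβ hb1 hb2 => ?_⟩
  have := (Finset.sum_eq_zero_iff_of_nonneg h3).1 h5 β (by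
    simp only [Finset.mem_erase]
    exact ⟨hb2, hb1, by simpa [hF] using hβ⟩)
  simp only [hf] at this
  linarith

end RootSystem

section Alcove

open Filter Topology

variable {E : Type*} [NormedAddCommGroup E] [InnerProductSpace ℝ E] {Φ : Set E}

/-! ### Euclidean planes -/

theorem exists_orthogonal_ne_zero (hE : Module.finrank ℝ E = 2) {a : E} (ha : a ≠ 0) :
    ∃ v : E, v ≠ 0 ∧ (inner ℝ v a : ℝ) = 0 := by
  have : Fact (Module.finrank ℝ E = 1 + 1) := ⟨hE⟩
  have h1 : Module.finrank ℝ (ℝ ∙ a)ᗮ = 1 := Submodule.finrank_orthogonal_span_singleton ha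
  have : Nontrivial (ℝ ∙ a)ᗮ := Module.nontrivial_of_finrank_pos (R := ℝ) (by omega)
  obtain ⟨v, hv⟩ := exists_ne (0 : (ℝ ∙ a)ᗮ)
  refine ⟨v, by simpa using hv, ?_⟩
  rw [real_inner_comm]
  exact Submodule.mem_orthogonal_singleton_iff_inner_right.1 v.2

theorem exists_eq_smul_of_orthogonal (hE : Module.finrank ℝ E = 2) {v a b : E} (hv : v ≠ 0)
    (ha : a ≠ 0) (hva : (inner ℝ v a : ℝ) = 0) (hvb : (inner ℝ v b : ℝ) = 0) :
    ∃ t : ℝ, b = t • a := by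
  have : Fact (Module.finrank ℝ E = 1 + 1) := ⟨hE⟩
  have h1 : Module.finrank ℝ (ℝ ∙ v)ᗮ = 1 := Submodule.finrank_orthogonal_span_singleton hv
  have ha' := Submodule.mem_orthogonal_singleton_iff_inner_right.2 hva
  have hb' := Submodule.mem_orthogonal_singleton_iff_inner_right.2 hvb
  obtain ⟨t, ht⟩ := (finrank_eq_one_iff_of_nonzero' (⟨a, ha'⟩ : (ℝ ∙ v)ᗮ)
    (by simpa using ha)).1 h1 ⟨b, hb'⟩
  exact ⟨t, by simpa using (congrArg Subtype.val ht).symm⟩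

theorem IsRootSystem.eq_or_eq_neg (hΦ : IsRootSystem Φ) {α β : E} (hα : α ∈ Φ) (hβ : β ∈ Φ)
    {t : ℝ} (h : β = t • α) : β = α ∨ β = -α := by
  rcases hΦ.reduced α hα t (h ▸ hβ) with rfl | rfl
  · left; simpa using h
  · right; simpa using h

theorem IsRootSystem.inner_ne_zero_of_orthogonal (hE : Module.finrank ℝ E = 2)
    (hΦ : IsRootSystem Φ) {v γ δ : E} (hv : v ≠ 0) (hγ : γ ∈ Φ) (hδ : δ ∈ Φ)
    (h : (inner ℝ v γ : ℝ) = 0) (h1 : δ ≠ γ) (h2 : δ ≠ -γ) : (inner ℝ v δ : ℝ) ≠ 0 := by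
  intro h0
  obtain ⟨t, ht⟩ := exists_eq_smul_of_orthogonal hE hv (hΦ.ne_zero hγ) h h0
  rcases hΦ.eq_or_eq_neg hγ hδ ht with h | h
  · exact h1 h
  · exact h2 h

/-! ### Hyperplanes -/

/-- The hyperplane `H_{γ,k}`. -/
def hyperplane (γ : E) (k : ℝ) : AffineSubspace ℝ E where
  carrier := {x | (inner ℝ x γ : ℝ) = k}
  smul_vsub_vadd_mem' := by
    intro c p q r hp hq hr
    simp only [Set.mem_ofPred_eq] at *
    simp only [vsub_eq_sub, vadd_eq_add, inner_add_left, real_inner_smul_left, inner_sub_left]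
    rw [hp, hq, hr]
    ring

theorem mem_hyperplane {γ : E} {k : ℝ} {x : E} :
    x ∈ hyperplane γ k ↔ (inner ℝ x γ : ℝ) = k := Iff.rfl

theorem affineReflection_eq_self_iff {γ : E} (hγ : γ ≠ 0) {k : ℝ} {x : E} :
    affineReflection γ k x = x ↔ (inner ℝ x γ : ℝ) = k := by
  have hc : coroot γ ≠ 0 := by
    intro h
    have := inner_self_coroot hγ
    rw [h, inner_zero_right] at this
    norm_num at this
  rw [affineReflection_apply, sub_eq_self, smul_eq_zero, or_iff_left hc, sub_eq_zero]

theorem wall_mkReflection (hΦ : IsRootSystem Φ) {γ : E} (hγ : γ ∈ Φ) (k : ℤ) :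
    wall Φ (mkReflection hγ k) = hyperplane γ k := by
  have : {x | (mkReflection hγ k : Equiv.Perm E) x = x} = (hyperplane γ (k : ℝ) : Set E) := by
    ext x
    exact affineReflection_eq_self_iff (hΦ.ne_zero hγ)
  rw [wall, this, AffineSubspace.affineSpan_coe]

theorem exists_mem_hyperplane {γ : E} (hγ : γ ≠ 0) (k : ℝ) : ∃ x, x ∈ hyperplane γ k := by
  have : (inner ℝ γ γ : ℝ) ≠ 0 := inner_self_ne_zero.mpr hγ
  refine ⟨(k / inner ℝ γ γ) • γ, ?_⟩
  rw [mem_hyperplane, real_inner_smul_left]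
  field_simp

theorem hyperplane_parallel {γ : E} (hγ : γ ≠ 0) (k l : ℝ) :
    (hyperplane γ k).Parallel (hyperplane γ l) := by
  have h0 : (inner ℝ γ γ : ℝ) ≠ 0 := inner_self_ne_zero.mpr hγ
  refine ⟨((l - k) / inner ℝ γ γ) • γ, ?_⟩
  ext x
  simp only [AffineSubspace.mem_map, AffineEquiv.coe_toAffineMap, AffineEquiv.constVAdd_apply,
    vadd_eq_add, mem_hyperplane]
  constructor
  · intro hx
    refine ⟨x - ((l - k) / inner ℝ γ γ) • γ, ?_, by abel⟩
    rw [inner_sub_left, real_inner_smul_left, hx]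
    field_simp
    ring
  · rintro ⟨y, hy, rfl⟩
    rw [inner_add_left, real_inner_smul_left, hy]
    field_simp
    ring

theorem IsRootSystem.eq_or_eq_neg_of_parallel (hE : Module.finrank ℝ E = 2)
    (hΦ : IsRootSystem Φ) {γ δ : E} (hγ : γ ∈ Φ) (hδ : δ ∈ Φ) {k l : ℝ}
    (h : (hyperplane γ k).Parallel (hyperplane δ l)) : δ = γ ∨ δ = -γ := by
  obtain ⟨v, hv0, hv⟩ := exists_orthogonal_ne_zero hE (hΦ.ne_zero hγ)
  obtain ⟨x, hx⟩ := exists_mem_hyperplane (hΦ.ne_zero hγ) k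
  obtain ⟨u, hu⟩ := h
  have key : ∀ y ∈ hyperplane γ k, (inner ℝ (u + y) δ : ℝ) = l := by
    intro y hy
    rw [← mem_hyperplane, hu]
    exact ⟨y, hy, rfl⟩
  have h1 := key x hx
  have h2 := key (x + v) (by rw [mem_hyperplane, inner_add_left, hv, mem_hyperplane.1 hx, add_zero])
  have h3 : (inner ℝ v δ : ℝ) = 0 := by
    simp only [inner_add_left] at h1 h2
    linarith
  by_contra hcon
  push Not at hcon
  exact hΦ.inner_ne_zero_of_orthogonal hE hv0 hγ hδ hv hcon.1 hcon.2 h3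

theorem hyperplane_sOppSide {γ : E} {k : ℝ} {x y : E} (hx : (inner ℝ x γ : ℝ) < k)
    (hy : k < inner ℝ y γ) : (hyperplane γ k).SOppSide x y := by
  have hd : 0 < (inner ℝ y γ : ℝ) - inner ℝ x γ := by linarith
  refine ⟨AffineSubspace.wOppSide_iff_exists_wbtw.2
    ⟨AffineMap.lineMap x y ((k - inner ℝ x γ) / (inner ℝ y γ - inner ℝ x γ)), ?_, _, ?_, rfl⟩,
    fun h => hx.ne h, fun h => hy.ne' h⟩
  · rw [mem_hyperplane, AffineMap.lineMap_apply, vsub_eq_sub, vadd_eq_add, inner_add_left,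
      real_inner_smul_left, inner_sub_left]
    field_simp
    ring
  · constructor
    · apply div_nonneg <;> linarith
    · rw [div_le_one hd]; linarith

/-! ### The alcove of a regular point -/

variable (Φ) in
/-- The alcove that contains the regular point `p`. -/
def alcove (p : E) : Set E := {x | ∀ δ ∈ Φ, (inner ℝ x δ : ℝ) < level δ p + 1}

theorem level_lt_inner_of_mem_alcove (hΦ : IsRootSystem Φ) {p : E} (hp : p ∈ regularPoints Φ)
    {x : E} (hx : x ∈ alcove Φ p) {δ : E} (hδ : δ ∈ Φ) : (level δ p : ℝ) < inner ℝ x δ := by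
  have := hx _ (hΦ.neg_mem hδ)
  rw [level_neg hp hδ, inner_neg_right] at this
  push_cast at this
  linarith

theorem level_eq_of_mem_alcove (hΦ : IsRootSystem Φ) {p : E} (hp : p ∈ regularPoints Φ)
    {x : E} (hx : x ∈ alcove Φ p) {δ : E} (hδ : δ ∈ Φ) : level δ x = level δ p := by
  rw [level, Int.floor_eq_iff]
  exact ⟨(level_lt_inner_of_mem_alcove hΦ hp hx hδ).le, hx δ hδ⟩

theorem alcove_subset_regularPoints (hΦ : IsRootSystem Φ) {p : E} (hp : p ∈ regularPoints Φ) :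
    alcove Φ p ⊆ regularPoints Φ := by
  intro x hx δ hδ k h
  have h1 := level_lt_inner_of_mem_alcove hΦ hp hx hδ
  have h2 := hx δ hδ
  rw [h] at h1 h2
  norm_cast at h1 h2
  omega

theorem self_mem_alcove (p : E) : p ∈ alcove Φ p := fun _ _ => inner_lt_level _ _

theorem convex_alcove (p : E) : Convex ℝ (alcove Φ p) := by
  intro x hx y hy a b ha hb hab δ hδ
  rw [inner_add_left, real_inner_smul_left, real_inner_smul_left]
  have h1 := hx δ hδ
  have h2 := hy δ hδ
  rcases ha.eq_or_lt with rfl | ha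
  · have : b = 1 := by linarith
    subst this
    linarith
  · have h3 := mul_lt_mul_of_pos_left h1 ha
    have h4 := mul_le_mul_of_nonneg_left h2.le hb
    have h5 : a * ((level δ p : ℝ) + 1) + b * (level δ p + 1) = level δ p + 1 := by
      rw [← add_mul, hab, one_mul]
    linarith

theorem isOpen_alcove (hΦ : IsRootSystem Φ) (p : E) : IsOpen (alcove Φ p) := by
  have : alcove Φ p = ⋂ δ ∈ Φ, {x | (inner ℝ x δ : ℝ) < level δ p + 1} := by
    ext x; simp [alcove]
  rw [this]
  exact hΦ.finite.isOpen_biInter fun δ _ => isOpen_lt (by fun_prop) continuous_const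

theorem connectedComponentIn_eq_alcove (hΦ : IsRootSystem Φ) {p : E}
    (hp : p ∈ regularPoints Φ) : connectedComponentIn (regularPoints Φ) p = alcove Φ p := by
  apply Set.Subset.antisymm
  · intro x hx δ hδ
    by_contra hcon
    push Not at hcon
    have hpc : IsPreconnected (connectedComponentIn (regularPoints Φ) p) :=
      isPreconnected_connectedComponentIn
    have hpm := mem_connectedComponentIn hp
    obtain ⟨y, hy, hy'⟩ := hpc.intermediate_value hpm hx
      (f := fun y => (inner ℝ y δ : ℝ)) (by fun_prop) ⟨(inner_lt_level p δ).le, hcon⟩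
    exact connectedComponentIn_subset _ _ hy δ hδ (level δ p + 1) (by push_cast; exact hy')
  · exact (convex_alcove p).isPreconnected.subset_connectedComponentIn (self_mem_alcove p)
      (alcove_subset_regularPoints hΦ hp)

theorem mem_closure_alcove_iff {p x : E} :
    x ∈ closure (alcove Φ p) ↔ ∀ δ ∈ Φ, (inner ℝ x δ : ℝ) ≤ level δ p + 1 := by
  constructor
  · intro hx δ hδ
    have hcl : IsClosed {x : E | (inner ℝ x δ : ℝ) ≤ level δ p + 1} :=
      isClosed_le (by fun_prop) continuous_const
    exact hcl.closure_subset_iff.2 (fun y hy => (hy δ hδ).le) hx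
  · intro hx
    have h0 : (0 : ℝ) ∈ closure (Set.Ioc (0 : ℝ) 1) := by
      rw [closure_Ioc (by norm_num)]; simp
    have hf : Continuous fun t : ℝ => x + t • (p - x) := by fun_prop
    have := map_mem_closure hf h0 (t := alcove Φ p) (by
      intro t ht δ hδ
      have h1 := hx δ hδ
      have h2 := inner_lt_level p δ
      simp only [inner_add_left, real_inner_smul_left, inner_sub_left]
      have h3 : 0 < t * (level δ p + 1 - inner ℝ p δ) := mul_pos ht.1 (by linarith)
      have h4 : 0 ≤ (1 - t) * (level δ p + 1 - inner ℝ x δ) :=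
        mul_nonneg (by linarith [ht.2]) (by linarith)
      nlinarith)
    simpa using this

theorem level_le_inner_of_mem_closure (hΦ : IsRootSystem Φ) {p : E} (hp : p ∈ regularPoints Φ)
    {x : E} (hx : x ∈ closure (alcove Φ p)) {δ : E} (hδ : δ ∈ Φ) :
    (level δ p : ℝ) ≤ inner ℝ x δ := by
  have := (mem_closure_alcove_iff).1 hx _ (hΦ.neg_mem hδ)
  rw [level_neg hp hδ, inner_neg_right] at this
  push_cast at this
  linarith

/-! ### Simple reflections -/

theorem simpleReflection_spec (hE : Module.finrank ℝ E = 2) (hΦ : IsRootSystem Φ) {p : E}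
    (hp : p ∈ regularPoints Φ) {s : affineWeylGroup Φ}
    (hs : s ∈ simpleReflections Φ (alcove Φ p)) :
    ∃ (γ : E) (hγ : γ ∈ Φ), s = mkReflection hγ (level γ p + 1) ∧
      ∀ δ ∈ Φ, δ ≠ γ → δ ≠ -γ → level δ ((s : Equiv.Perm E) p) = level δ p := by
  obtain ⟨hr, hspan⟩ := hs
  obtain ⟨γ, hγ, j, rfl⟩ := isReflection_iff.1 hr
  have hγ0 := hΦ.ne_zero hγ
  rw [wall_mkReflection hΦ] at hspan
  obtain ⟨v, hv0, hv⟩ := exists_orthogonal_ne_zero hE hγ0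
  obtain ⟨z, hz⟩ := exists_mem_hyperplane hγ0 (j : ℝ)
  have hz' : z + v ∈ hyperplane γ (j : ℝ) := by
    rw [mem_hyperplane, inner_add_left, hv, mem_hyperplane.1 hz, add_zero]
  have hnt : (closure (alcove Φ p) ∩ (hyperplane γ (j : ℝ) : Set E)).Nontrivial := by
    rw [← Set.not_subsingleton_iff]
    intro hsub
    rcases hsub.eq_empty_or_singleton with h | ⟨x, h⟩
    · rw [h, AffineSubspace.span_empty] at hspan
      rw [← hspan] at hz
      exact AffineSubspace.notMem_bot ℝ E z hz
    · rw [h] at hspan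
      rw [← hspan, AffineSubspace.mem_affineSpan_singleton] at hz hz'
      rw [hz] at hz'
      exact hv0 (by simpa using hz')
  obtain ⟨a, ⟨ha, haH⟩, b, ⟨hb, hbH⟩, hab⟩ := hnt
  have haH' : (inner ℝ a γ : ℝ) = j := haH
  have hbH' : (inner ℝ b γ : ℝ) = j := hbH
  set m : E := (1 / 2 : ℝ) • (a + b) with hm
  have hmi : ∀ δ, (inner ℝ m δ : ℝ) = (inner ℝ a δ + inner ℝ b δ) / 2 := by
    intro δ
    rw [hm, real_inner_smul_left, inner_add_left]; ring
  have hmc : m ∈ closure (alcove Φ p) := by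
    rw [mem_closure_alcove_iff] at *
    intro δ hδ
    rw [hmi]
    linarith [ha δ hδ, hb δ hδ]
  have hsm : affineReflection γ j m = m := by
    rw [affineReflection_eq_self_iff hγ0, hmi, haH', hbH']; ring
  have hlev : ∀ δ ∈ Φ, δ ≠ γ → δ ≠ -γ → level δ (affineReflection γ j p) = level δ p := by
    intro δ hδ h1 h2
    have hnotint : ∀ k : ℤ, (inner ℝ m δ : ℝ) ≠ k := by
      intro k hk
      have hne : (inner ℝ (a - b) δ : ℝ) ≠ 0 :=
        hΦ.inner_ne_zero_of_orthogonal hE (sub_ne_zero.2 hab) hγ hδ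
          (by rw [inner_sub_left, haH', hbH', sub_self]) h1 h2
      apply hne
      rw [hmi] at hk
      rw [inner_sub_left]
      have a1 := (mem_closure_alcove_iff).1 ha δ hδ
      have b1 := (mem_closure_alcove_iff).1 hb δ hδ
      have a2 := level_le_inner_of_mem_closure hΦ hp ha hδ
      have b2 := level_le_inner_of_mem_closure hΦ hp hb hδ
      have k1 : level δ p ≤ k := by
        have : (level δ p : ℝ) ≤ k := by linarith
        exact_mod_cast this
      have k2 : k ≤ level δ p + 1 := by
        have : (k : ℝ) ≤ level δ p + 1 := by linarith
        exact_mod_cast this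
      rcases (by omega : k = level δ p ∨ k = level δ p + 1) with rfl | rfl
      · linarith
      · push_cast at hk; linarith
    obtain ⟨L, -, g2, -, g4⟩ := exists_level_smul hΦ (mkReflection hγ j)
    obtain ⟨n, hn, hn'⟩ := g4 δ hδ
    have hn1 := hn m
    have hn2 := hn' p
    rw [coe_mkReflection] at hn1 hn2
    rw [hsm] at hn1
    have c1 := (mem_closure_alcove_iff).1 hmc _ (g2 δ hδ)
    have c2 := level_le_inner_of_mem_closure hΦ hp hmc (g2 δ hδ)
    have c3 := (mem_closure_alcove_iff).1 hmc δ hδ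
    have c4 := level_le_inner_of_mem_closure hΦ hp hmc hδ
    have d1 : level δ p = ⌊(inner ℝ m δ : ℝ)⌋ := by
      symm
      rw [Int.floor_eq_iff]
      refine ⟨c4, lt_of_le_of_ne c3 ?_⟩
      have := hnotint (level δ p + 1)
      push_cast at this
      exact this
    rw [hn2, d1]
    symm
    rw [Int.floor_eq_iff]
    push_cast
    refine ⟨by linarith, lt_of_le_of_ne (by linarith) ?_⟩
    have := hnotint (level (L.symm δ) p + n + 1)
    push_cast at this
    exact this
  have e1 := (mem_closure_alcove_iff).1 ha γ hγ
  have e2 := level_le_inner_of_mem_closure hΦ hp ha hγ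
  rw [haH'] at e1 e2
  norm_cast at e1 e2
  rcases (by omega : j = level γ p + 1 ∨ j = level γ p) with h | h
  · refine ⟨γ, hγ, by rw [h], ?_⟩
    intro δ hδ h1 h2
    exact hlev δ hδ h1 h2
  · refine ⟨-γ, hΦ.neg_mem hγ, ?_, ?_⟩
    · rw [level_neg hp hγ, ← mkReflection_neg hΦ hγ j]
      congr 1
      omega
    · intro δ hδ h1 h2
      exact hlev δ hδ (by simpa using h2) h1

theorem mkReflection_mem_simpleReflections (hΦ : IsRootSystem Φ) {p : E}
    {α : E} (hα : α ∈ Φ) {y : E} (hy : (inner ℝ y α : ℝ) = level α p + 1)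
    (hy' : ∀ δ ∈ Φ, δ ≠ α → (inner ℝ y δ : ℝ) < level δ p + 1) :
    mkReflection hα (level α p + 1) ∈ simpleReflections Φ (alcove Φ p) := by
  refine ⟨isReflection_iff.2 ⟨α, hα, _, rfl⟩, ?_⟩
  rw [wall_mkReflection hΦ]
  set H := hyperplane α ((level α p + 1 : ℤ) : ℝ) with hH
  have hyH : y ∈ H := by
    rw [hH, mem_hyperplane, hy]; push_cast; rfl
  have hycl : y ∈ closure (alcove Φ p) := by
    rw [mem_closure_alcove_iff]
    intro δ hδ
    by_cases h : δ = α
    · rw [h, hy]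
    · exact (hy' δ hδ h).le
  apply le_antisymm
  · exact affineSpan_le.2 Set.inter_subset_right
  · intro x hx
    have hd : (inner ℝ (x - y) α : ℝ) = 0 := by
      rw [inner_sub_left, mem_hyperplane.1 hx, mem_hyperplane.1 hyH, sub_self]
    have hev : ∀ᶠ ε in 𝓝[>] (0 : ℝ), ∀ δ ∈ Φ \ {α},
        (inner ℝ (y + ε • (x - y)) δ : ℝ) < level δ p + 1 := by
      rw [eventually_all_finite (hΦ.finite.subset Set.sdiff_subset)]
      intro δ hδ
      have hc : ContinuousAt (fun ε : ℝ => (inner ℝ (y + ε • (x - y)) δ : ℝ)) 0 := by fun_prop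
      apply nhdsWithin_le_nhds
      apply hc.eventually_lt continuousAt_const
      simpa using hy' δ hδ.1 hδ.2
    obtain ⟨ε, hε, hε0⟩ := (hev.and self_mem_nhdsWithin).exists
    have hε0 : 0 < ε := hε0
    have hεH : (inner ℝ (y + ε • (x - y)) α : ℝ) = level α p + 1 := by
      rw [inner_add_left, real_inner_smul_left, hd, hy]; ring
    have hmem : y + ε • (x - y) ∈ closure (alcove Φ p) ∩ (H : Set E) := by
      refine ⟨?_, ?_⟩
      · rw [mem_closure_alcove_iff]
        intro δ hδ
        by_cases h : δ = α
        · rw [h, hεH]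
        · exact (hε δ ⟨hδ, h⟩).le
      · change (inner ℝ (y + ε • (x - y)) α : ℝ) = _
        rw [hεH]; push_cast; rfl
    have hx' : x = AffineMap.lineMap y (y + ε • (x - y)) (1 / ε) := by
      rw [AffineMap.lineMap_apply, vsub_eq_sub, vadd_eq_add, add_sub_cancel_left, smul_smul,
        one_div, inv_mul_cancel₀ hε0.ne', one_smul, sub_add_cancel]
    rw [hx']
    exact AffineMap.lineMap_mem _ (subset_affineSpan ℝ _ ⟨hycl, hyH⟩)
      (subset_affineSpan ℝ _ hmem)

theorem exists_mem_open_inner_ne {ι : Type*} (s : Finset ι) (v : ι → E) (c : ι → ℝ)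
    (hv : ∀ i ∈ s, v i ≠ 0) {U : Set E} (hU : IsOpen U) (hne : U.Nonempty) :
    ∃ x ∈ U, ∀ i ∈ s, (inner ℝ x (v i) : ℝ) ≠ c i := by
  classical
  induction s using Finset.induction_on generalizing U with
  | empty => exact ⟨hne.some, hne.some_mem, by simp⟩
  | insert i s _ ih =>
    obtain ⟨x, hx⟩ := hne
    have hvi := hv i (Finset.mem_insert_self i s)
    have hne' : (U ∩ {x | (inner ℝ x (v i) : ℝ) ≠ c i}).Nonempty := by
      by_cases h : (inner ℝ x (v i) : ℝ) = c i
      · have hc : ContinuousAt (fun ε : ℝ => x + ε • v i) 0 := by fun_prop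
        have hev : ∀ᶠ ε in 𝓝[>] (0 : ℝ), x + ε • v i ∈ U := by
          apply nhdsWithin_le_nhds
          apply hc.eventually_mem
          apply hU.mem_nhds
          simpa using hx
        obtain ⟨ε, hε, hε0⟩ := (hev.and self_mem_nhdsWithin).exists
        have hε0 : 0 < ε := hε0
        refine ⟨_, hε, ?_⟩
        have h0 : (inner ℝ (v i) (v i) : ℝ) ≠ 0 := inner_self_ne_zero.mpr hvi
        simp only [Set.mem_ofPred_eq, inner_add_left, real_inner_smul_left, h]
        simpa using ⟨hε0.ne', hvi⟩
      · exact ⟨x, hx, h⟩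
    obtain ⟨y, hy, hy'⟩ := ih (fun i hi => hv i (Finset.mem_insert_of_mem hi))
      (hU.inter (isOpen_ne_fun (by fun_prop) continuous_const)) hne'
    refine ⟨y, hy.1, ?_⟩
    simp only [Finset.forall_mem_insert]
    exact ⟨hy.2, hy'⟩

/-- A point beyond some hyperplane of the arrangement that bounds a strip containing the alcove
is beyond a wall of the alcove. -/
theorem exists_simpleReflection_lt (hΦ : IsRootSystem Φ) {p z : E}
    (hz : ∃ δ ∈ Φ, (level δ p + 1 : ℝ) < inner ℝ z δ) :
    ∃ (α : E) (hα : α ∈ Φ), mkReflection hα (level α p + 1) ∈ simpleReflections Φ (alcove Φ p) ∧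
      (level α p + 1 : ℝ) < inner ℝ z α := by
  classical
  set b : E → ℝ := fun δ => level δ p + 1 with hb
  set V : Set E := {δ | δ ∈ Φ ∧ b δ < inner ℝ z δ} with hV
  have hVf : V.Finite := hΦ.finite.subset fun δ h => h.1
  have hVne : V.Nonempty := by
    obtain ⟨δ, h1, h2⟩ := hz
    exact ⟨δ, h1, h2⟩
  obtain ⟨q, hq, hgen⟩ := exists_mem_open_inner_ne
    ((hVf.toFinset ×ˢ hVf.toFinset).filter fun i => i.1 ≠ i.2)
    (fun i => (inner ℝ z i.1 - b i.1) • i.2 - (inner ℝ z i.2 - b i.2) • i.1)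
    (fun i => b i.2 * inner ℝ z i.1 - b i.1 * inner ℝ z i.2) (by
      rintro ⟨α, β⟩ hi h0
      simp only [Finset.mem_filter, Finset.mem_product, Set.Finite.mem_toFinset] at hi h0
      obtain ⟨⟨⟨hα, hα'⟩, ⟨hβ, hβ'⟩⟩, hne⟩ := hi
      have hA : 0 < inner ℝ z α - b α := by linarith
      have hB : 0 < inner ℝ z β - b β := by linarith
      have h1 : β = ((inner ℝ z β - b β) / (inner ℝ z α - b α)) • α := by
        rw [div_eq_inv_mul, mul_smul, ← sub_eq_zero.1 h0, smul_smul, inv_mul_cancel₀ hA.ne',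
          one_smul]
      rcases hΦ.reduced α hα _ (h1 ▸ hβ) with h | h
      · rw [h, one_smul] at h1
        exact hne h1.symm
      · have : 0 < (inner ℝ z β - b β) / (inner ℝ z α - b α) := by positivity
        linarith) (isOpen_alcove hΦ p) ⟨p, self_mem_alcove p⟩
  set t : E → ℝ := fun δ => (b δ - inner ℝ q δ) / (inner ℝ z δ - inner ℝ q δ) with ht
  obtain ⟨α, ⟨hα, hαz⟩, hmin⟩ := Set.exists_min_image V t hVf hVne
  have hqα : (inner ℝ q α : ℝ) < b α := hq α hα
  have hαd : 0 < (inner ℝ z α : ℝ) - inner ℝ q α := by linarith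
  have ht0 : 0 < t α := div_pos (by linarith) hαd
  have ht1 : t α < 1 := by
    rw [ht]; simp only; rw [div_lt_one hαd]; linarith
  refine ⟨α, hα, mkReflection_mem_simpleReflections hΦ hα (y := q + t α • (z - q)) ?_ ?_, hαz⟩
  · rw [inner_add_left, real_inner_smul_left, inner_sub_left]
    simp only [ht]
    rw [div_mul_cancel₀ _ hαd.ne']
    simp [hb]
  · intro δ hδ hne
    rw [inner_add_left, real_inner_smul_left, inner_sub_left]
    have hqδ : (inner ℝ q δ : ℝ) < b δ := hq δ hδ
    change _ < b δ
    by_cases hδV : b δ < inner ℝ z δ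
    · have hδd : 0 < (inner ℝ z δ : ℝ) - inner ℝ q δ := by linarith
      have hle := hmin δ ⟨hδ, hδV⟩
      have hlt : t α < t δ := by
        refine lt_of_le_of_ne hle fun heq => ?_
        have hg := hgen (α, δ) (by simp [hV, hα, hδ, hαz, hδV, hne.symm])
        apply hg
        simp only [ht] at heq
        rw [div_eq_div_iff hαd.ne' hδd.ne'] at heq
        simp only [inner_sub_right, real_inner_smul_right]
        linear_combination heq
      have h1 := (mul_lt_mul_iff_left₀ hδd).2 hlt
      have h2 : t δ * (inner ℝ z δ - inner ℝ q δ) = b δ - inner ℝ q δ :=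
        div_mul_cancel₀ _ hδd.ne'
      linarith
    · push Not at hδV
      nlinarith

end Alcove

/-! ### Words and galleries -/

section Words

variable {G : Type*} [Group G] {S : Set G}

theorem length_prod_le {l : List G} (hl : ∀ s ∈ l, s ∈ S) : length S l.prod ≤ l.length :=
  Nat.sInf_le ⟨l, hl, rfl, rfl⟩

theorem exists_reduced_word (hS : ∀ s ∈ S, s⁻¹ = s) {w : G} (hw : w ∈ Subgroup.closure S) :
    ∃ l : List G, (∀ s ∈ l, s ∈ S) ∧ l.length = length S w ∧ l.prod = w := by
  rw [← Subgroup.mem_toSubmonoid, Subgroup.closure_toSubmonoid] at hw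
  obtain ⟨l, hl, hlw⟩ := Submonoid.exists_list_of_mem_closure hw
  refine Nat.sInf_mem (s := {n | ∃ l : List G, (∀ s ∈ l, s ∈ S) ∧ l.length = n ∧ l.prod = w})
    ⟨l.length, l, fun s hs => ?_, rfl, hlw⟩
  rcases hl s hs with h | h
  · exact h
  · have := hS _ (Set.mem_inv.1 h)
    rw [inv_inv] at this
    rwa [this]

theorem length_mul_le (hS : ∀ s ∈ S, s⁻¹ = s) {w s : G} (hw : w ∈ Subgroup.closure S)
    (hs : s ∈ S) : length S (w * s) ≤ length S w + 1 := by
  obtain ⟨l, hl, hlen, rfl⟩ := exists_reduced_word hS hw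
  have := length_prod_le (S := S) (l := l ++ [s]) (by
    intro t ht
    rcases List.mem_append.1 ht with h | h
    · exact hl t h
    · rw [List.mem_singleton.1 h]; exact hs)
  simp only [List.prod_append, List.prod_singleton, List.length_append, List.length_singleton]
    at this
  omega

theorem IsGallery.mem_types {c : G} {γ : List (G × G)} (h : IsGallery S c γ) :
    ∀ s ∈ γ.map Prod.fst, s ∈ S := by
  induction γ generalizing c with
  | nil => simp
  | cons a γ ih =>
    obtain ⟨s, d⟩ := a
    obtain ⟨hs, -, h⟩ := h
    intro t ht
    rcases List.mem_cons.1 ht with rfl | ht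
    · exact hs
    · exact ih h t ht

theorem IsGallery.exists_sublist {c : G} {γ : List (G × G)} (h : IsGallery S c γ) :
    ∃ l : List G, l.Sublist (γ.map Prod.fst) ∧ lastAlcove c γ = c * l.prod := by
  induction γ generalizing c with
  | nil => exact ⟨[], by simp, by simp [lastAlcove]⟩
  | cons a γ ih =>
    obtain ⟨s, d⟩ := a
    obtain ⟨hs, hd, h⟩ := h
    obtain ⟨l, hl, hlast⟩ := ih h
    rcases hd with rfl | rfl
    · exact ⟨l, hl.cons s, hlast⟩
    · refine ⟨s :: l, hl.cons_cons s, ?_⟩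
      rw [List.prod_cons, ← mul_assoc]
      exact hlast

theorem IsGallery.map_mul {c : G} {γ : List (G × G)} (h : IsGallery S c γ) (g : G) :
    IsGallery S (g * c) (γ.map fun p => (p.1, g * p.2)) := by
  induction γ generalizing c with
  | nil => trivial
  | cons a γ ih =>
    obtain ⟨s, d⟩ := a
    obtain ⟨hs, hd, h⟩ := h
    refine ⟨hs, ?_, ih h⟩
    rcases hd with rfl | rfl
    · left; rfl
    · right; simp [mul_assoc]

theorem IsGallery.fold (hS : ∀ s ∈ S, s⁻¹ = s) {c : G} {γ : List (G × G)}
    (h : IsGallery S c γ) (i : ℕ) : IsGallery S c (fold c γ i) := by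
  induction γ generalizing c i with
  | nil => cases i <;> trivial
  | cons a γ ih =>
    obtain ⟨s, d⟩ := a
    obtain ⟨hs, hd, h⟩ := h
    cases i with
    | succ i => exact ⟨hs, hd, ih h i⟩
    | zero =>
      refine ⟨hs, ?_, h.map_mul _⟩
      rcases hd with rfl | rfl
      · right
        change d * s * d⁻¹ * d = d * s
        group
      · left
        change c * s * c⁻¹ * (c * s) = c
        have : s * s = 1 := by
          nth_rewrite 1 [← hS s hs]
          exact inv_mul_cancel s
        calc c * s * c⁻¹ * (c * s) = c * (s * s) := by group
          _ = c := by rw [this, mul_one]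

theorem map_fst_fold (c : G) (γ : List (G × G)) (i : ℕ) :
    (fold c γ i).map Prod.fst = γ.map Prod.fst := by
  induction γ generalizing c i with
  | nil => cases i <;> rfl
  | cons a γ ih =>
    obtain ⟨s, d⟩ := a
    cases i with
    | succ i => simp [fold, ih]
    | zero => simp [fold]

theorem isGallery_of_word (c : G) {l : List G} (hl : ∀ s ∈ l, s ∈ S) :
    ∃ γ, IsGallery S c γ ∧ lastAlcove c γ = c * l.prod ∧ γ.length = l.length := by
  induction l generalizing c with
  | nil => exact ⟨[], trivial, by simp [lastAlcove], rfl⟩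
  | cons s l ih =>
    obtain ⟨γ, h1, h2, h3⟩ := ih (c * s) fun t ht => hl t (List.mem_cons_of_mem _ ht)
    refine ⟨(s, c * s) :: γ, ⟨hl s List.mem_cons_self, Or.inr rfl, h1⟩, ?_, by simp [h3]⟩
    rw [List.prod_cons, ← mul_assoc]
    exact h2

/-- An element of the shadow of `w` is the product of a subword of a reduced word for `w`. -/
theorem exists_subword_of_mem_shadow (hS : ∀ s ∈ S, s⁻¹ = s) {x w : G}
    (hw : w ∈ Subgroup.closure S) (hx : x ∈ shadow S w) :
    ∃ l l' : List G, (∀ s ∈ l, s ∈ S) ∧ l.length = length S w ∧ l.prod = w ∧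
      l'.Sublist l ∧ l'.prod = x := by
  obtain ⟨γ, ⟨hγ, hlast, hmin⟩, I, rfl⟩ := hx
  obtain ⟨l₀, hl₀, hlen₀, hprod₀⟩ := exists_reduced_word hS hw
  obtain ⟨γ₀, hγ₀, hlast₀, hlenγ₀⟩ := isGallery_of_word (S := S) 1 hl₀
  have h1 := hmin γ₀ hγ₀ (by rw [hlast₀, one_mul, hprod₀])
  obtain ⟨l, hl, hlw⟩ := hγ.exists_sublist
  rw [hlast, one_mul] at hlw
  have h2 := length_prod_le (S := S) (l := l) fun s hs => hγ.mem_types s (hl.subset hs)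
  rw [← hlw] at h2
  have h3 := hl.length_le
  rw [List.length_map] at h3
  have h4 : l = γ.map Prod.fst := hl.eq_of_length (by rw [List.length_map]; omega)
  have key : ∀ (I : List ℕ) (δ : List (G × G)), IsGallery S 1 δ →
      IsGallery S 1 (I.foldl (AffineCoxeter.fold 1) δ) ∧
        (I.foldl (AffineCoxeter.fold 1) δ).map Prod.fst = δ.map Prod.fst := by
    intro I
    induction I with
    | nil => exact fun δ hδ => ⟨hδ, rfl⟩
    | cons i I ih =>
      intro δ hδ
      obtain ⟨h5, h6⟩ := ih _ (hδ.fold hS i)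
      exact ⟨h5, h6.trans (map_fst_fold _ _ _)⟩
  obtain ⟨h5, h6⟩ := key I γ hγ
  obtain ⟨l', hl', hlast'⟩ := h5.exists_sublist
  refine ⟨γ.map Prod.fst, l', hγ.mem_types, by rw [List.length_map]; omega, by rw [← h4, hlw],
    by rwa [h6] at hl', ?_⟩
  rw [hlast', one_mul]

end Words

section Bruhat

open Filter Topology

variable {E : Type*} [NormedAddCommGroup E] [InnerProductSpace ℝ E] {Φ : Set E}

/-! ### The affine Weyl group is generated by the simple reflections -/

theorem coe_mul_apply (g h : affineWeylGroup Φ) (x : E) :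
    ((g * h : affineWeylGroup Φ) : Equiv.Perm E) x
      = (g : Equiv.Perm E) ((h : Equiv.Perm E) x) := rfl

theorem inv_apply_apply (g : affineWeylGroup Φ) (x : E) :
    ((g⁻¹ : affineWeylGroup Φ) : Equiv.Perm E) ((g : Equiv.Perm E) x) = x := by
  rw [← coe_mul_apply, inv_mul_cancel]; rfl

theorem inv_of_mem_simpleReflections {C : Set E} {s : affineWeylGroup Φ}
    (hs : s ∈ simpleReflections Φ C) : s⁻¹ = s := by
  obtain ⟨γ, hγ, j, rfl⟩ := isReflection_iff.1 hs.1
  exact mkReflection_inv hγ j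

theorem wallDist_nonneg (hΦ : IsRootSystem Φ) (p q : E) : 0 ≤ wallDist hΦ p q :=
  Finset.sum_nonneg fun _ _ => abs_nonneg _

theorem exists_smul_mem_alcove (hΦ : IsRootSystem Φ) {p : E} (hp : p ∈ regularPoints Φ) {z : E}
    (hz : z ∈ regularPoints Φ) :
    ∃ g ∈ Subgroup.closure (simpleReflections Φ (alcove Φ p)),
      (g : Equiv.Perm E) z ∈ alcove Φ p := by
  induction hn : (wallDist hΦ z p).toNat using Nat.strong_induction_on generalizing z with
  | _ n ih =>
    by_cases hza : z ∈ alcove Φ p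
    · exact ⟨1, one_mem _, hza⟩
    · simp only [alcove, Set.mem_ofPred_eq, not_forall, not_lt] at hza
      obtain ⟨δ, hδ, hle⟩ := hza
      obtain ⟨α, hα, hs, hlt⟩ := exists_simpleReflection_lt hΦ (p := p) (z := z)
        ⟨δ, hδ, lt_of_le_of_ne hle (by
          have := hz δ hδ (level δ p + 1)
          push_cast at this
          exact this.symm)⟩
      set s := mkReflection hα (level α p + 1)
      have hsz : (s : Equiv.Perm E) z ∈ regularPoints Φ := smul_mem_regularPoints hΦ s hz
      have hlevz : level α p + 1 ≤ level α z := by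
        rw [lt_level_iff hz hα]
        push_cast
        exact hlt
      have hlev : level α ((s : Equiv.Perm E) z) = 2 * (level α p + 1) - 1 - level α z :=
        level_self_mkReflection hΦ hα _ hz
      have h1 := (wallDist_reflection hΦ hα (a := level α p + 1) hsz hp (by
        unfold Separates; omega)).1
      rw [show affineReflection α ((level α p + 1 : ℤ) : ℝ) ((s : Equiv.Perm E) z) = z from
        affineReflection_affineReflection _ _ _] at h1
      have h2 := wallDist_nonneg hΦ ((s : Equiv.Perm E) z) p
      obtain ⟨g, hg, hgz⟩ := ih _ (by omega) hsz rfl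
      exact ⟨g * s, mul_mem hg (Subgroup.subset_closure hs), hgz⟩

theorem exists_real_forall_ne_int {ι : Type*} {s : Set ι} (hs : s.Finite) (a b : ι → ℝ)
    (hb : ∀ i ∈ s, b i ≠ 0) : ∃ t : ℝ, ∀ i ∈ s, ∀ m : ℤ, a i + t * b i ≠ m := by
  have hc : (⋃ i ∈ s, Set.range fun m : ℤ => ((m : ℝ) - a i) / b i).Countable :=
    hs.countable.biUnion fun i _ => Set.countable_range _
  have hne : (⋃ i ∈ s, Set.range fun m : ℤ => ((m : ℝ) - a i) / b i) ≠ Set.univ := by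
    intro h
    rw [h] at hc
    exact Set.not_countable_univ hc
  obtain ⟨t, ht⟩ := (Set.ne_univ_iff_exists_notMem _).1 hne
  refine ⟨t, fun i hi m h => ht ?_⟩
  simp only [Set.mem_iUnion, Set.mem_range]
  refine ⟨i, hi, m, ?_⟩
  have := hb i hi
  field_simp
  linarith

/-- Every hyperplane is the only one that separates some regular point from its mirror image. -/
theorem exists_regular_adjacent (hE : Module.finrank ℝ E = 2) (hΦ : IsRootSystem Φ) {γ : E}
    (hγ : γ ∈ Φ) (k : ℤ) : ∃ z ∈ regularPoints Φ, level γ z = k ∧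
      ∀ δ ∈ Φ, δ ≠ γ → δ ≠ -γ → level δ (affineReflection γ k z) = level δ z := by
  have hγ0 := hΦ.ne_zero hγ
  obtain ⟨v, hv0, hv⟩ := exists_orthogonal_ne_zero hE hγ0
  obtain ⟨z₀, hz₀⟩ := exists_mem_hyperplane hγ0 (k : ℝ)
  rw [mem_hyperplane] at hz₀
  obtain ⟨τ, hτ⟩ := exists_real_forall_ne_int (s := {δ | δ ∈ Φ ∧ δ ≠ γ ∧ δ ≠ -γ})
    (hΦ.finite.subset fun δ h => h.1) (fun δ => inner ℝ z₀ δ) (fun δ => inner ℝ v δ)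
    fun δ hδ => hΦ.inner_ne_zero_of_orthogonal hE hv0 hγ hδ.1 hv hδ.2.1 hδ.2.2
  set z₁ := z₀ + τ • v with hz₁
  have hz₁γ : (inner ℝ z₁ γ : ℝ) = k := by
    rw [hz₁, inner_add_left, real_inner_smul_left, hv, hz₀]; ring
  have hz₁δ : ∀ δ ∈ Φ, δ ≠ γ → δ ≠ -γ → ∀ m : ℤ, (inner ℝ z₁ δ : ℝ) ≠ m := by
    intro δ h1 h2 h3 m
    rw [hz₁, inner_add_left, real_inner_smul_left]
    exact hτ δ ⟨h1, h2, h3⟩ m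
  have hev : ∀ f : ℝ → E, Continuous f → f 0 = z₁ →
      ∀ᶠ ε in 𝓝[>] (0 : ℝ), ∀ δ ∈ {δ | δ ∈ Φ ∧ δ ≠ γ ∧ δ ≠ -γ},
        ((⌊(inner ℝ z₁ δ : ℝ)⌋ : ℝ) < inner ℝ (f ε) δ) ∧
          ((inner ℝ (f ε) δ : ℝ) < ⌊(inner ℝ z₁ δ : ℝ)⌋ + 1) := by
    intro f hf hf0
    rw [eventually_all_finite (hΦ.finite.subset fun δ h => h.1)]
    intro δ hδ
    have hc : ContinuousAt (fun ε : ℝ => (inner ℝ (f ε) δ : ℝ)) 0 :=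
      (hf.inner continuous_const).continuousAt
    apply nhdsWithin_le_nhds
    apply Filter.Eventually.and
    · apply continuousAt_const.eventually_lt hc
      rw [hf0]
      exact lt_of_le_of_ne (Int.floor_le _) (hz₁δ δ hδ.1 hδ.2.1 hδ.2.2 _).symm
    · apply hc.eventually_lt continuousAt_const
      rw [hf0]
      exact Int.lt_floor_add_one _
  have hγγ : 0 < (inner ℝ γ γ : ℝ) := real_inner_self_pos.2 hγ0
  have hcr : Continuous (affineReflection γ (k : ℝ)) := by
    have : (affineReflection γ (k : ℝ) : E → E)
        = fun x => x - (inner ℝ x γ - (k : ℝ)) • coroot γ := rfl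
    rw [this]
    fun_prop
  have hev1 := hev (fun ε => z₁ + ε • γ) (by fun_prop) (by simp)
  have hev2 := hev (fun ε => affineReflection γ k (z₁ + ε • γ))
    (hcr.comp (by fun_prop)) (by simp [affineReflection_eq_self_iff hγ0, hz₁γ])
  have hev3 : ∀ᶠ ε in 𝓝[>] (0 : ℝ), ε * inner ℝ γ γ < 1 := by
    apply nhdsWithin_le_nhds
    have hc : ContinuousAt (fun ε : ℝ => ε * (inner ℝ γ γ : ℝ)) 0 := by fun_prop
    exact hc.eventually_lt continuousAt_const (by simp)
  obtain ⟨ε, ⟨⟨h1, h2⟩, h3⟩, hε0⟩ := (((hev1.and hev2).and hev3).and self_mem_nhdsWithin).exists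
  have hε0 : 0 < ε := hε0
  have hzγ : (inner ℝ (z₁ + ε • γ) γ : ℝ) = k + ε * inner ℝ γ γ := by
    rw [inner_add_left, real_inner_smul_left, hz₁γ]
  have hpos : 0 < ε * inner ℝ γ γ := by positivity
  refine ⟨z₁ + ε • γ, fun δ hδ m hm => ?_, ?_, fun δ hδ hδ1 hδ2 => ?_⟩
  · by_cases hδ1 : δ = γ
    · rw [hδ1, hzγ] at hm
      have a1 : (k : ℝ) < m := by linarith
      have a2 : (m : ℝ) < k + 1 := by linarith
      norm_cast at a1 a2
      omega
    · by_cases hδ2 : δ = -γ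
      · rw [hδ2, inner_neg_right, hzγ] at hm
        have a1 : (m : ℝ) < -k := by linarith
        have a2 : (-k : ℝ) < m + 1 := by linarith
        norm_cast at a1 a2
        omega
      · obtain ⟨a1, a2⟩ := h1 δ ⟨hδ, hδ1, hδ2⟩
        rw [hm] at a1 a2
        norm_cast at a1 a2
        omega
  · rw [level, Int.floor_eq_iff, hzγ]
    constructor <;> linarith
  · obtain ⟨a1, a2⟩ := h1 δ ⟨hδ, hδ1, hδ2⟩
    obtain ⟨b1, b2⟩ := h2 δ ⟨hδ, hδ1, hδ2⟩
    rw [level, level, Int.floor_eq_iff.2 ⟨a1.le, a2⟩, Int.floor_eq_iff.2 ⟨b1.le, b2⟩]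

theorem mkReflection_mem_closure (hE : Module.finrank ℝ E = 2) (hΦ : IsRootSystem Φ) {p : E}
    (hp : p ∈ regularPoints Φ) {γ : E} (hγ : γ ∈ Φ) (k : ℤ) :
    mkReflection hγ k ∈ Subgroup.closure (simpleReflections Φ (alcove Φ p)) := by
  obtain ⟨z, hz, hzk, hzδ⟩ := exists_regular_adjacent hE hΦ hγ k
  obtain ⟨g, hg, hgz⟩ := exists_smul_mem_alcove hΦ hp hz
  set r := mkReflection hγ k with hr
  have hrz : (r : Equiv.Perm E) z ∈ regularPoints Φ := smul_mem_regularPoints hΦ r hz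
  have hrk : level γ ((r : Equiv.Perm E) z) = k - 1 := by
    have := level_self_mkReflection hΦ hγ k hz
    rw [hr, coe_mkReflection, this, hzk]; ring
  obtain ⟨γ', hγ', k', -, hsep⟩ := exists_conj_mkReflection hΦ g hγ k
  have hsep' := (hsep z ((r : Equiv.Perm E) z)).2 (by unfold Separates; omega)
  set q := (g : Equiv.Perm E) ((r : Equiv.Perm E) z) with hq
  have hqr : q ∈ regularPoints Φ := smul_mem_regularPoints hΦ g hrz
  have hqa : q ∉ alcove Φ p := by
    intro h
    have h1 := level_eq_of_mem_alcove hΦ hp h hγ'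
    have h2 := level_eq_of_mem_alcove hΦ hp hgz hγ'
    unfold Separates at hsep'
    omega
  simp only [alcove, Set.mem_ofPred_eq, not_forall, not_lt] at hqa
  obtain ⟨δ, hδ, hle⟩ := hqa
  obtain ⟨α, hα, hs, hlt⟩ := exists_simpleReflection_lt hΦ (p := p) (z := q)
    ⟨δ, hδ, lt_of_le_of_ne hle (by
      have := hqr δ hδ (level δ p + 1)
      push_cast at this
      exact this.symm)⟩
  have h1 : Separates α (level α p + 1) ((g : Equiv.Perm E) z) q := by
    left
    rw [level_eq_of_mem_alcove hΦ hp hgz hα, lt_level_iff hqr hα]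
    exact ⟨by omega, by push_cast; exact hlt⟩
  obtain ⟨β, hβ, j, hconj, hsepβ⟩ := exists_conj_mkReflection hΦ g⁻¹ hα (level α p + 1)
  have h2 := (hsepβ _ _).2 h1
  rw [inv_apply_apply, hq, inv_apply_apply] at h2
  have h3 : mkReflection hβ j = r := by
    by_cases hb1 : β = γ
    · subst hb1
      have : j = k := by unfold Separates at h2; omega
      rw [this]
    · by_cases hb2 : β = -γ
      · subst hb2
        have : j = -k := by
          unfold Separates at h2
          rw [level_neg hz hγ, level_neg hrz hγ] at h2
          omega
        rw [this]
        exact mkReflection_neg hΦ hγ k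
      · exfalso
        have := hzδ β hβ hb1 hb2
        rw [← coe_mkReflection hγ, ← hr] at this
        unfold Separates at h2
        omega
  rw [← h3, ← hconj]
  exact mul_mem (mul_mem (inv_mem hg) (Subgroup.subset_closure hs)) (inv_mem (inv_mem hg))

theorem mem_closure_simpleReflections (hE : Module.finrank ℝ E = 2) (hΦ : IsRootSystem Φ) {p : E}
    (hp : p ∈ regularPoints Φ) (g : affineWeylGroup Φ) :
    g ∈ Subgroup.closure (simpleReflections Φ (alcove Φ p)) := by
  obtain ⟨g, hg⟩ := g
  induction hg using Subgroup.closure_induction with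
  | mem x hx =>
    obtain ⟨α, hα, k, rfl⟩ := hx
    exact mkReflection_mem_closure hE hΦ hp hα k
  | one => exact one_mem _
  | mul x y hx hy h1 h2 => exact mul_mem h1 h2
  | inv x hx h => exact inv_mem h

/-! ### Length and separating hyperplanes -/

theorem wallDist_simpleReflection (hE : Module.finrank ℝ E = 2) (hΦ : IsRootSystem Φ) {p : E}
    (hp : p ∈ regularPoints Φ) {s : affineWeylGroup Φ}
    (hs : s ∈ simpleReflections Φ (alcove Φ p)) :
    wallDist hΦ ((s : Equiv.Perm E) p) p ≤ 2 := by
  classical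
  obtain ⟨γ, hγ, hsγ, hlev⟩ := simpleReflection_spec hE hΦ hp hs
  have h1 : level γ ((s : Equiv.Perm E) p) = level γ p + 1 := by
    rw [hsγ, coe_mkReflection, level_self_mkReflection hΦ hγ _ hp]; ring
  have hsr := smul_mem_regularPoints hΦ s hp
  unfold wallDist
  calc ∑ δ ∈ hΦ.finite.toFinset, |level δ ((s : Equiv.Perm E) p) - level δ p|
      ≤ ∑ δ ∈ hΦ.finite.toFinset, if δ ∈ ({γ, -γ} : Finset E) then 1 else 0 := by
        refine Finset.sum_le_sum fun δ hδ => ?_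
        have hδ' : δ ∈ Φ := by simpa using hδ
        by_cases h2 : δ = γ
        · subst h2; simp [h1]
        · by_cases h3 : δ = -γ
          · subst h3
            rw [level_neg hsr hγ, level_neg hp hγ, h1]
            simp
          · simp [hlev δ hδ' h2 h3, h2, h3]
    _ = ((hΦ.finite.toFinset ∩ {γ, -γ}).card : ℤ) := by
        rw [Finset.sum_ite_mem]; simp
    _ ≤ 2 := by
        have := (Finset.card_le_card (Finset.inter_subset_right
          (s₁ := hΦ.finite.toFinset) (s₂ := {γ, -γ}))).trans Finset.card_le_two
        exact_mod_cast this

theorem exists_wall_smul (hE : Module.finrank ℝ E = 2) (hΦ : IsRootSystem Φ) {p : E}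
    (hp : p ∈ regularPoints Φ) {s : affineWeylGroup Φ}
    (hs : s ∈ simpleReflections Φ (alcove Φ p)) (x : affineWeylGroup Φ) :
    ∃ (γ : E) (hγ : γ ∈ Φ) (k : ℤ), x * s * x⁻¹ = mkReflection hγ k ∧
      Separates γ k ((x : Equiv.Perm E) p) (((x * s : affineWeylGroup Φ) : Equiv.Perm E) p) := by
  obtain ⟨γ, hγ, hsγ, -⟩ := simpleReflection_spec hE hΦ hp hs
  obtain ⟨γ', hγ', k', h1, h2⟩ := exists_conj_mkReflection hΦ x hγ (level γ p + 1)
  refine ⟨γ', hγ', k', by rw [hsγ, h1], ?_⟩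
  rw [Subgroup.coe_mul, Equiv.Perm.mul_apply, h2, hsγ, coe_mkReflection]
  unfold Separates
  rw [level_self_mkReflection hΦ hγ _ hp]
  omega

theorem mkReflection_eq_of_separates (hE : Module.finrank ℝ E = 2) (hΦ : IsRootSystem Φ) {p : E}
    (hp : p ∈ regularPoints Φ) {s : affineWeylGroup Φ}
    (hs : s ∈ simpleReflections Φ (alcove Φ p)) {x : affineWeylGroup Φ} {δ : E} (hδ : δ ∈ Φ)
    {k : ℤ} (h : Separates δ k ((x : Equiv.Perm E) p) (((x * s : affineWeylGroup Φ) : Equiv.Perm E) p)) :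
    mkReflection hδ k = x * s * x⁻¹ := by
  obtain ⟨γ, hγ, hsγ, hlev⟩ := simpleReflection_spec hE hΦ hp hs
  obtain ⟨δ', hδ', k', h1, h2⟩ := exists_conj_mkReflection hΦ x⁻¹ hδ k
  have h3 := (h2 _ _).2 h
  rw [Subgroup.coe_mul, Equiv.Perm.mul_apply, inv_apply_apply, inv_apply_apply] at h3
  have hlevγ : level γ ((s : Equiv.Perm E) p) = level γ p + 1 := by
    rw [hsγ, coe_mkReflection, level_self_mkReflection hΦ hγ _ hp]; ring
  have hsr := smul_mem_regularPoints hΦ s hp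
  have h4 : mkReflection hδ' k' = s := by
    by_cases hb1 : δ' = γ
    · subst hb1
      have : k' = level δ' p + 1 := by unfold Separates at h3; omega
      rw [hsγ, this]
    · by_cases hb2 : δ' = -γ
      · subst hb2
        have : k' = -(level γ p + 1) := by
          unfold Separates at h3
          rw [level_neg hp hγ, level_neg hsr hγ] at h3
          omega
        rw [hsγ, this]
        exact mkReflection_neg hΦ hγ _
      · exfalso
        have := hlev δ' hδ' hb1 hb2
        unfold Separates at h3
        omega
  rw [← h4, ← h1]
  group

theorem exchange (hE : Module.finrank ℝ E = 2) (hΦ : IsRootSystem Φ) {p : E}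
    (hp : p ∈ regularPoints Φ) {l : List (affineWeylGroup Φ)}
    (hl : ∀ s ∈ l, s ∈ simpleReflections Φ (alcove Φ p)) {δ : E} (hδ : δ ∈ Φ) {k : ℤ}
    (h : Separates δ k p (((l.prod : affineWeylGroup Φ) : Equiv.Perm E) p)) :
    ∃ l' : List (affineWeylGroup Φ), (∀ s ∈ l', s ∈ simpleReflections Φ (alcove Φ p)) ∧
      l'.length + 1 = l.length ∧ mkReflection hδ k * l.prod = l'.prod := by
  induction l using List.reverseRecOn with
  | nil => exfalso; unfold Separates at h; simp at h; omega
  | append_singleton l s ih =>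
    have hs := hl s (by simp)
    have hl' : ∀ t ∈ l, t ∈ simpleReflections Φ (alcove Φ p) := fun t ht => hl t (by simp [ht])
    rw [List.prod_append, List.prod_singleton] at h ⊢
    by_cases h1 : Separates δ k p (((l.prod : affineWeylGroup Φ) : Equiv.Perm E) p)
    · obtain ⟨l', a1, a2, a3⟩ := ih hl' h1
      refine ⟨l' ++ [s], ?_, by simp; omega, ?_⟩
      · intro t ht
        rcases List.mem_append.1 ht with ht | ht
        · exact a1 t ht
        · rw [List.mem_singleton.1 ht]; exact hs
      · rw [List.prod_append, List.prod_singleton, ← mul_assoc, a3]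
    · rw [separates_trans_iff h1] at h
      have h2 := mkReflection_eq_of_separates hE hΦ hp hs hδ h
      refine ⟨l, hl', by simp, ?_⟩
      have h3 : s * s = 1 := by
        nth_rewrite 1 [← inv_of_mem_simpleReflections hs]
        exact inv_mul_cancel s
      calc mkReflection hδ k * (l.prod * s) = l.prod * (s * s) := by rw [h2]; group
        _ = l.prod := by rw [h3, mul_one]

theorem wallDist_word (hE : Module.finrank ℝ E = 2) (hΦ : IsRootSystem Φ) {p : E}
    (hp : p ∈ regularPoints Φ) {l : List (affineWeylGroup Φ)}
    (hl : ∀ s ∈ l, s ∈ simpleReflections Φ (alcove Φ p))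
    (hred : length (simpleReflections Φ (alcove Φ p)) l.prod = l.length) :
    wallDist hΦ (((l.prod : affineWeylGroup Φ) : Equiv.Perm E) p) p = 2 * l.length := by
  induction l using List.reverseRecOn with
  | nil => simp [wallDist_self]
  | append_singleton l s ih =>
    have hs := hl s (by simp)
    have hl' : ∀ t ∈ l, t ∈ simpleReflections Φ (alcove Φ p) := fun t ht => hl t (by simp [ht])
    rw [List.prod_append, List.prod_singleton, List.length_append, List.length_singleton] at *
    have h1 := length_mul_le (fun _ => inv_of_mem_simpleReflections)
      (mem_closure_simpleReflections hE hΦ hp l.prod) hs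
    have h2 := length_prod_le hl'
    have h3 := ih hl' (by omega)
    obtain ⟨γ, hγ, k, h4, h5⟩ := exists_wall_smul hE hΦ hp hs l.prod
    have h6 : l.prod * s = mkReflection hγ k * l.prod := by rw [← h4]; group
    have h7 : ¬ Separates γ k p (((l.prod : affineWeylGroup Φ) : Equiv.Perm E) p) := by
      intro h
      obtain ⟨l', a1, a2, a3⟩ := exchange hE hΦ hp hl' hγ h
      have := length_prod_le a1
      rw [← a3, ← h6] at this
      omega
    have h8 := (wallDist_reflection hΦ hγ (smul_mem_regularPoints hΦ l.prod hp) hp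
      fun h => h7 h.symm).1
    rw [← coe_mkReflection hγ, ← coe_mul_apply, ← h6] at h8
    have h9 := wallDist_triangle hΦ (((l.prod * s : affineWeylGroup Φ) : Equiv.Perm E) p)
      (((l.prod : affineWeylGroup Φ) : Equiv.Perm E) p) p
    have h10 := wallDist_simpleReflection hE hΦ hp hs
    rw [← wallDist_smul hΦ l.prod, ← coe_mul_apply] at h10
    push_cast at *
    linarith

/-- The length of `g` is the number of hyperplanes that separate the alcoves `1` and `g`. -/
theorem wallDist_eq_length (hE : Module.finrank ℝ E = 2) (hΦ : IsRootSystem Φ) {p : E}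
    (hp : p ∈ regularPoints Φ) (g : affineWeylGroup Φ) :
    wallDist hΦ ((g : Equiv.Perm E) p) p
      = 2 * (length (simpleReflections Φ (alcove Φ p)) g : ℤ) := by
  obtain ⟨l, h1, h2, rfl⟩ := exists_reduced_word (fun _ => inv_of_mem_simpleReflections)
    (mem_closure_simpleReflections hE hΦ hp g)
  rw [wallDist_word hE hΦ hp h1 h2.symm, h2]

/-! ### The Bruhat order -/

variable (Φ) in
/-- `y` arises from `x` by a reflection in a hyperplane that does not separate `x` from the alcove
of `p`. -/
def BruhatStep (p : E) (x y : affineWeylGroup Φ) : Prop :=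
  ∃ (γ : E) (hγ : γ ∈ Φ) (k : ℤ), y = mkReflection hγ k * x ∧
    ¬ Separates γ k p ((x : Equiv.Perm E) p)

variable (Φ) in
/-- The Bruhat order with respect to the alcove of `p`. -/
def BruhatLE (p : E) : affineWeylGroup Φ → affineWeylGroup Φ → Prop :=
  Relation.ReflTransGen (BruhatStep Φ p)

theorem length_mkReflection_mul (hE : Module.finrank ℝ E = 2) (hΦ : IsRootSystem Φ) {p : E}
    (hp : p ∈ regularPoints Φ) {γ : E} (hγ : γ ∈ Φ) {k : ℤ} {x : affineWeylGroup Φ}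
    (h : ¬ Separates γ k p ((x : Equiv.Perm E) p)) :
    length (simpleReflections Φ (alcove Φ p)) x
      < length (simpleReflections Φ (alcove Φ p)) (mkReflection hγ k * x) := by
  have h1 := (wallDist_reflection hΦ hγ (smul_mem_regularPoints hΦ x hp) hp
    fun h' => h h'.symm).1
  rw [← coe_mkReflection hγ, ← coe_mul_apply, wallDist_eq_length hE hΦ hp,
    wallDist_eq_length hE hΦ hp] at h1
  omega

theorem not_separates_of_length_lt (hE : Module.finrank ℝ E = 2) (hΦ : IsRootSystem Φ) {p : E}
    (hp : p ∈ regularPoints Φ) {γ : E} (hγ : γ ∈ Φ) {k : ℤ} {x : affineWeylGroup Φ}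
    (h : length (simpleReflections Φ (alcove Φ p)) x
      < length (simpleReflections Φ (alcove Φ p)) (mkReflection hγ k * x)) :
    ¬ Separates γ k p ((x : Equiv.Perm E) p) := by
  intro hsep
  have h1 : ¬ Separates γ k p (((mkReflection hγ k * x : affineWeylGroup Φ) : Equiv.Perm E) p) := by
    rw [coe_mul_apply, coe_mkReflection]
    unfold Separates at *
    rw [level_self_mkReflection hΦ hγ _ (smul_mem_regularPoints hΦ x hp)]
    omega
  have h2 := length_mkReflection_mul hE hΦ hp hγ h1
  rw [← mul_assoc, mkReflection_mul_self, one_mul] at h2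
  omega

theorem BruhatLE.eq_or_length_lt (hE : Module.finrank ℝ E = 2) (hΦ : IsRootSystem Φ) {p : E}
    (hp : p ∈ regularPoints Φ) {x y : affineWeylGroup Φ} (h : BruhatLE Φ p x y) :
    x = y ∨ length (simpleReflections Φ (alcove Φ p)) x
      < length (simpleReflections Φ (alcove Φ p)) y := by
  induction h using Relation.ReflTransGen.head_induction_on with
  | refl => left; rfl
  | head h _ ih =>
    obtain ⟨γ, hγ, k, rfl, hsep⟩ := h
    have := length_mkReflection_mul hE hΦ hp hγ hsep
    right
    rcases ih with rfl | ih
    · exact this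
    · exact this.trans ih

theorem BruhatLE.mul_simpleReflection (hE : Module.finrank ℝ E = 2) (hΦ : IsRootSystem Φ) {p : E}
    (hp : p ∈ regularPoints Φ) {s : affineWeylGroup Φ}
    (hs : s ∈ simpleReflections Φ (alcove Φ p)) {x y : affineWeylGroup Φ}
    (h : BruhatLE Φ p x y) : BruhatLE Φ p (x * s) y ∨ BruhatLE Φ p (x * s) (y * s) := by
  induction h using Relation.ReflTransGen.head_induction_on with
  | refl => right; exact Relation.ReflTransGen.refl
  | @head x z hxz hzy ih =>
    obtain ⟨γ, hγ, k, rfl, hsep⟩ := hxz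
    by_cases ht : mkReflection hγ k = x * s * x⁻¹
    · left
      have : x * s = mkReflection hγ k * x := by rw [ht]; group
      rw [this]
      exact hzy
    · have hstep : BruhatStep Φ p (x * s) (mkReflection hγ k * x * s) := by
        refine ⟨γ, hγ, k, by rw [mul_assoc], fun h => ht ?_⟩
        rw [separates_trans_iff hsep] at h
        exact mkReflection_eq_of_separates hE hΦ hp hs hγ h
      exact ih.imp (Relation.ReflTransGen.head hstep) (Relation.ReflTransGen.head hstep)

theorem bruhatLE_of_sublist (hE : Module.finrank ℝ E = 2) (hΦ : IsRootSystem Φ) {p : E}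
    (hp : p ∈ regularPoints Φ) {l l' : List (affineWeylGroup Φ)}
    (hl : ∀ s ∈ l, s ∈ simpleReflections Φ (alcove Φ p))
    (hred : length (simpleReflections Φ (alcove Φ p)) l.prod = l.length) (h : l'.Sublist l) :
    BruhatLE Φ p l'.prod l.prod := by
  induction l using List.reverseRecOn generalizing l' with
  | nil => rw [List.sublist_nil.1 h]; exact Relation.ReflTransGen.refl
  | append_singleton l s ih =>
    have hs := hl s (by simp)
    have hl' : ∀ t ∈ l, t ∈ simpleReflections Φ (alcove Φ p) := fun t ht => hl t (by simp [ht])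
    rw [List.prod_append, List.prod_singleton, List.length_append, List.length_singleton] at *
    have h1 := length_mul_le (fun _ => inv_of_mem_simpleReflections)
      (mem_closure_simpleReflections hE hΦ hp l.prod) hs
    have h2 := length_prod_le hl'
    have hred' : length (simpleReflections Φ (alcove Φ p)) l.prod = l.length := by omega
    have hle : BruhatLE Φ p l.prod (l.prod * s) := by
      obtain ⟨γ, hγ, k, h4, -⟩ := exists_wall_smul hE hΦ hp hs l.prod
      have h6 : l.prod * s = mkReflection hγ k * l.prod := by rw [← h4]; group
      refine Relation.ReflTransGen.single ⟨γ, hγ, k, h6, ?_⟩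
      apply not_separates_of_length_lt hE hΦ hp hγ
      rw [← h6]
      omega
    obtain ⟨l₁, l₂, rfl, h3, h4⟩ := List.sublist_append_iff.1 h
    have h5 := ih hl' hred' h3
    rcases List.sublist_singleton.1 h4 with rfl | rfl
    · rw [List.append_nil]
      exact h5.trans hle
    · rw [List.prod_append, List.prod_singleton]
      rcases h5.mul_simpleReflection hE hΦ hp hs with h6 | h6
      · exact h6.trans hle
      · exact h6

theorem bruhatLE_of_mem_shadow (hE : Module.finrank ℝ E = 2) (hΦ : IsRootSystem Φ) {p : E}
    (hp : p ∈ regularPoints Φ) {x y : affineWeylGroup Φ}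
    (h : x ∈ shadow (simpleReflections Φ (alcove Φ p)) y) : BruhatLE Φ p x y := by
  obtain ⟨l, l', h1, h2, rfl, h4, rfl⟩ := exists_subword_of_mem_shadow
    (fun _ => inv_of_mem_simpleReflections) (mem_closure_simpleReflections hE hΦ hp y) h
  exact bruhatLE_of_sublist hE hΦ hp h1 h2.symm h4

end Bruhat

section SimplePair

variable {E : Type*} [NormedAddCommGroup E] [InnerProductSpace ℝ E] {Φ : Set E}

/-! ### Bases of plane root systems -/

variable (Φ) in
/-- `{α, β}` is a base of the root system `Φ` in a plane. -/
structure IsSimplePair (α β : E) : Prop where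
  left_mem : α ∈ Φ
  right_mem : β ∈ Φ
  indep : ∀ x y : ℝ, x • β + y • α = 0 → x = 0 ∧ y = 0
  nonneg : ∀ γ ∈ Φ, ∃ x y : ℝ, 0 ≤ x ∧ 0 ≤ y ∧ (γ = x • β + y • α ∨ γ = -(x • β + y • α))

namespace IsSimplePair

variable {α β : E}

theorem coeff_unique (h : IsSimplePair Φ α β) {x y x' y' : ℝ}
    (heq : x • β + y • α = x' • β + y' • α) : x = x' ∧ y = y' := by
  have := h.indep (x - x') (y - y') (by
    rw [sub_smul, sub_smul, sub_add_sub_comm, heq, sub_self])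
  exact ⟨sub_eq_zero.1 this.1, sub_eq_zero.1 this.2⟩

theorem nonneg_of_pos (h : IsSimplePair Φ α β) {x y : ℝ} (hγ : x • β + y • α ∈ Φ) :
    (0 < x → 0 ≤ y) ∧ (0 < y → 0 ≤ x) := by
  obtain ⟨x', y', hx, hy, heq | heq⟩ := h.nonneg _ hγ
  · obtain ⟨rfl, rfl⟩ := h.coeff_unique heq
    exact ⟨fun _ => hy, fun _ => hx⟩
  · have : x • β + y • α = (-x') • β + (-y') • α := by rw [heq]; module
    obtain ⟨rfl, rfl⟩ := h.coeff_unique this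
    exact ⟨fun h => by linarith, fun h => by linarith⟩

theorem mirror (hΦ : IsRootSystem Φ) (h : IsSimplePair Φ α β) :
    IsSimplePair Φ α (-linearReflection α β) where
  left_mem := h.left_mem
  right_mem := hΦ.neg_mem (hΦ.linearReflection_mem h.left_mem h.right_mem)
  indep := by
    intro x y heq
    have h1 := congrArg (linearReflection α) heq
    rw [map_add, map_smul, map_smul, map_neg, linearReflection_linearReflection,
      linearReflection_self, map_zero] at h1
    have := h.indep (-x) (-y) (by rw [← h1]; module)
    exact ⟨neg_eq_zero.1 this.1, neg_eq_zero.1 this.2⟩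
  nonneg := by
    intro γ hγ
    obtain ⟨x, y, hx, hy, heq⟩ := h.nonneg _ (hΦ.linearReflection_mem h.left_mem hγ)
    refine ⟨x, y, hx, hy, ?_⟩
    rw [← linearReflection_linearReflection α γ]
    rcases heq with heq | heq
    · right
      rw [heq, map_add, map_smul, map_smul, linearReflection_self]
      module
    · left
      rw [heq, map_neg, map_add, map_smul, map_smul, linearReflection_self]
      module

theorem inner_coroot_nonpos (hΦ : IsRootSystem Φ) (h : IsSimplePair Φ α β) :
    (inner ℝ β (coroot α) : ℝ) ≤ 0 := by
  have h1 := hΦ.linearReflection_mem h.left_mem h.right_mem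
  rw [linearReflection_apply'] at h1
  have h2 : β - (inner ℝ β (coroot α) : ℝ) • α
      = (1 : ℝ) • β + (-(inner ℝ β (coroot α) : ℝ)) • α := by module
  rw [h2] at h1
  linarith [(h.nonneg_of_pos h1).1 one_pos]

theorem right_ne (h : IsSimplePair Φ α β) : β ≠ α ∧ β ≠ -α := by
  constructor <;> intro heq
  · have := h.indep 1 (-1) (by rw [heq]; module)
    norm_num at this
  · have := h.indep 1 1 (by rw [heq]; module)
    norm_num at this

/-- The fundamental weight that is orthogonal to `α`. -/
theorem exists_weight (hE : Module.finrank ℝ E = 2) (hΦ : IsRootSystem Φ)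
    (h : IsSimplePair Φ α β) :
    ∃ ϖ : E, (inner ℝ ϖ α : ℝ) = 0 ∧ (inner ℝ ϖ β : ℝ) = inner ℝ β β / 2 := by
  obtain ⟨e, he0, he⟩ := exists_orthogonal_ne_zero hE (hΦ.ne_zero h.left_mem)
  have heβ := hΦ.inner_ne_zero_of_orthogonal hE he0 h.left_mem h.right_mem he h.right_ne.1
    h.right_ne.2
  refine ⟨(inner ℝ β β / (2 * inner ℝ e β) : ℝ) • e, ?_, ?_⟩
  · rw [real_inner_smul_left, he, mul_zero]
  · rw [real_inner_smul_left]
    field_simp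

theorem exists_int_of_nonneg (hΦ : IsRootSystem Φ) (h : IsSimplePair Φ α β) {ϖ : E}
    (hα : (inner ℝ ϖ α : ℝ) = 0) (hβ : (inner ℝ ϖ β : ℝ) = inner ℝ β β / 2) (n : ℕ) {x y : ℝ}
    (hx : 0 ≤ x) (hy : 0 ≤ y) (hγ : x • β + y • α ∈ Φ) (hn : x + y < n) :
    ∃ a b m : ℤ, x = a ∧ y = b ∧ (inner ℝ ϖ (coroot (x • β + y • α)) : ℝ) = m := by
  induction n generalizing x y with
  | zero => exfalso; push_cast at hn; linarith
  | succ n ih =>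
    push_cast at hn
    set γ := x • β + y • α with hγdef
    have hββ : (0 : ℝ) < inner ℝ β β := real_inner_self_pos.2 (hΦ.ne_zero h.right_mem)
    have hαα : (0 : ℝ) < inner ℝ α α := real_inner_self_pos.2 (hΦ.ne_zero h.left_mem)
    have hγγ : (0 : ℝ) < inner ℝ γ γ := real_inner_self_pos.2 (hΦ.ne_zero hγ)
    rcases hx.eq_or_lt with hx0 | hx
    · have h1 : γ = y • α := by rw [hγdef, ← hx0]; module
      rcases hΦ.reduced α h.left_mem y (h1 ▸ hγ) with h2 | h2
      · refine ⟨0, 1, 0, by simp [hx0.symm], by simp [h2], ?_⟩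
        rw [h1, h2, one_smul, inner_coroot_right, hα]
        simp
      · linarith
    rcases hy.eq_or_lt with hy0 | hy
    · have h1 : γ = x • β := by rw [hγdef, ← hy0]; module
      rcases hΦ.reduced β h.right_mem x (h1 ▸ hγ) with h2 | h2
      · refine ⟨1, 0, 1, by simp [h2], by simp [hy0.symm], ?_⟩
        rw [h1, h2, one_smul, inner_coroot_right, hβ]
        field_simp
        simp
      · linarith
    have hsum : (inner ℝ γ γ : ℝ) = x * inner ℝ γ β + y * inner ℝ γ α := by
      nth_rewrite 2 [hγdef]
      rw [inner_add_right, real_inner_smul_right, real_inner_smul_right]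
    by_cases hc : 0 < (inner ℝ γ α : ℝ)
    · obtain ⟨k, hk⟩ := hΦ.exists_inner_coroot h.left_mem hγ
      have hk1 : (1 : ℝ) ≤ k := by
        have : (0 : ℝ) < k := by
          rw [← hk, inner_coroot_right]; positivity
        exact_mod_cast this
      have hr : linearReflection α γ = x • β + (y - k) • α := by
        rw [linearReflection_apply', hk, hγdef]; module
      have hmem := hΦ.linearReflection_mem h.left_mem hγ
      have hr' := hr ▸ hmem
      obtain ⟨a, b, m, h1, h2, h3⟩ := ih hx.le ((h.nonneg_of_pos hr').1 hx) hr' (by linarith)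
      refine ⟨a, b + k, m, h1, by push_cast; linarith, ?_⟩
      rw [← h3, ← hr, coroot_map, ← inner_linearReflection, linearReflection_apply, hα]
      simp
    · have hc' : 0 < (inner ℝ γ β : ℝ) := by
        by_contra hcon
        push Not at hc hcon
        nlinarith
      obtain ⟨k, hk⟩ := hΦ.exists_inner_coroot h.right_mem hγ
      have hk1 : (1 : ℝ) ≤ k := by
        have : (0 : ℝ) < k := by
          rw [← hk, inner_coroot_right]; positivity
        exact_mod_cast this
      have hr : linearReflection β γ = (x - k) • β + y • α := by
        rw [linearReflection_apply', hk, hγdef]; module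
      have hmem := hΦ.linearReflection_mem h.right_mem hγ
      have hr' := hr ▸ hmem
      obtain ⟨a, b, m, h1, h2, h3⟩ := ih ((h.nonneg_of_pos hr').2 hy) hy.le hr' (by linarith)
      obtain ⟨j, hj⟩ := hΦ.exists_inner_coroot hγ h.right_mem
      refine ⟨a + k, b, m + j, by push_cast; linarith, h2, ?_⟩
      have hϖ : linearReflection β ϖ = ϖ - β := by
        rw [linearReflection_apply', inner_coroot_right, hβ]
        have : (2 * (inner ℝ β β / 2) / inner ℝ β β : ℝ) = 1 := by field_simp
        rw [this, one_smul]
      rw [← hr, coroot_map, ← inner_linearReflection, hϖ, inner_sub_left, hj] at h3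
      push_cast
      linarith

theorem exists_int (hΦ : IsRootSystem Φ) (h : IsSimplePair Φ α β) {ϖ : E}
    (hα : (inner ℝ ϖ α : ℝ) = 0) (hβ : (inner ℝ ϖ β : ℝ) = inner ℝ β β / 2) {γ : E}
    (hγ : γ ∈ Φ) :
    ∃ a b m : ℤ, γ = (a : ℝ) • β + (b : ℝ) • α ∧ (inner ℝ ϖ (coroot γ) : ℝ) = m := by
  obtain ⟨x, y, hx, hy, rfl | rfl⟩ := h.nonneg γ hγ
  · obtain ⟨n, hn⟩ := exists_nat_gt (x + y)
    obtain ⟨a, b, m, rfl, rfl, h3⟩ := h.exists_int_of_nonneg hΦ hα hβ n hx hy hγ hn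
    exact ⟨a, b, m, rfl, h3⟩
  · obtain ⟨n, hn⟩ := exists_nat_gt (x + y)
    have hγ' := hΦ.neg_mem hγ
    rw [neg_neg] at hγ'
    obtain ⟨a, b, m, rfl, rfl, h3⟩ := h.exists_int_of_nonneg hΦ hα hβ n hx hy hγ' hn
    refine ⟨-a, -b, -m, by push_cast; module, ?_⟩
    rw [coroot_neg, inner_neg_right, h3]
    push_cast; rfl

end IsSimplePair

/-- Every root of a plane root system belongs to a base. -/
theorem IsRootSystem.exists_isSimplePair (hE : Module.finrank ℝ E = 2) (hΦ : IsRootSystem Φ)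
    {α : E} (hα : α ∈ Φ) : ∃ β, IsSimplePair Φ α β := by
  have hα0 := hΦ.ne_zero hα
  have hαα : (0 : ℝ) < inner ℝ α α := real_inner_self_pos.2 hα0
  obtain ⟨e, he0, he⟩ := exists_orthogonal_ne_zero hE hα0
  set P : Set E := {γ | γ ∈ Φ ∧ 0 < (inner ℝ e γ : ℝ)} with hP
  have hPf : P.Finite := hΦ.finite.subset fun γ h => h.1
  have hPne : P.Nonempty := by
    by_contra hcon
    rw [Set.not_nonempty_iff_eq_empty] at hcon
    have hzero : ∀ γ ∈ Φ, (inner ℝ e γ : ℝ) = 0 := by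
      intro γ hγ
      by_contra h0
      rcases lt_or_gt_of_ne h0 with h1 | h1
      · have : -γ ∈ P := ⟨hΦ.neg_mem hγ, by rw [inner_neg_right]; linarith⟩
        rw [hcon] at this
        exact this
      · have : γ ∈ P := ⟨hγ, h1⟩
        rw [hcon] at this
        exact this
    have hall : ∀ x ∈ Submodule.span ℝ Φ, (inner ℝ e x : ℝ) = 0 := by
      intro x hx
      induction hx using Submodule.span_induction with
      | mem x hx => exact hzero x hx
      | zero => exact inner_zero_right _
      | add x y _ _ h1 h2 => rw [inner_add_right, h1, h2, add_zero]
      | smul c x _ h1 => rw [real_inner_smul_right, h1, mul_zero]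
    have := hall e (by rw [hΦ.span_eq_top]; trivial)
    exact he0 (inner_self_eq_zero.1 this)
  obtain ⟨β, ⟨hβ, hβe⟩, hmin⟩ :=
    Set.exists_min_image P (fun γ => (inner ℝ γ α / inner ℝ e γ : ℝ)) hPf hPne
  have key : ∀ γ ∈ P, ∃ x y : ℝ, 0 ≤ x ∧ 0 ≤ y ∧ γ = x • β + y • α := by
    rintro γ ⟨hγ, hγe⟩
    set x : ℝ := inner ℝ e γ / inner ℝ e β with hx
    have hx0 : 0 < x := by positivity
    have h1 : (inner ℝ e (γ - x • β) : ℝ) = 0 := by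
      rw [inner_sub_right, real_inner_smul_right, hx]
      field_simp
      ring
    obtain ⟨y, hy⟩ := exists_eq_smul_of_orthogonal hE he0 hα0 he h1
    have h2 : (inner ℝ γ α : ℝ) - x * inner ℝ β α = y * inner ℝ α α := by
      rw [← real_inner_smul_left, ← inner_sub_left, hy, real_inner_smul_left]
    have h3 := hmin γ ⟨hγ, hγe⟩
    rw [div_le_div_iff₀ hβe hγe] at h3
    refine ⟨x, y, hx0.le, ?_, by rw [← hy]; abel⟩
    by_contra hneg
    push Not at hneg
    have h4 : (inner ℝ γ α : ℝ) - x * inner ℝ β α < 0 := by rw [h2]; nlinarith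
    have h5 : x * inner ℝ e β = inner ℝ e γ := by rw [hx]; field_simp
    have h6 : ((inner ℝ γ α : ℝ) - x * inner ℝ β α) * inner ℝ e β < 0 :=
      mul_neg_of_neg_of_pos h4 hβe
    rw [← h5] at h3
    nlinarith
  refine ⟨β, hα, hβ, fun x y hxy => ?_, fun γ hγ => ?_⟩
  · have h1 := congrArg (fun v => (inner ℝ e v : ℝ)) hxy
    simp only [inner_add_right, real_inner_smul_right, he, mul_zero, add_zero, inner_zero_right]
      at h1
    have hx : x = 0 := (mul_eq_zero.1 h1).resolve_right hβe.ne'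
    rw [hx, zero_smul, zero_add] at hxy
    exact ⟨hx, (smul_eq_zero.1 hxy).resolve_right hα0⟩
  · rcases lt_trichotomy (inner ℝ e γ : ℝ) 0 with h | h | h
    · obtain ⟨x, y, hx, hy, heq⟩ := key (-γ) ⟨hΦ.neg_mem hγ, by rw [inner_neg_right]; linarith⟩
      exact ⟨x, y, hx, hy, Or.inr (by rw [← heq, neg_neg])⟩
    · obtain ⟨t, ht⟩ := exists_eq_smul_of_orthogonal hE he0 hα0 he h
      refine ⟨0, 1, le_rfl, zero_le_one, ?_⟩
      rcases hΦ.eq_or_eq_neg hα hγ ht with h | h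
      · left; rw [h]; module
      · right; rw [h]; module
    · obtain ⟨x, y, hx, hy, heq⟩ := key γ ⟨hγ, h⟩
      exact ⟨x, y, hx, hy, Or.inl heq⟩

/-! ### The orbit of a fundamental weight -/

theorem int_ellipse_bounds {N c a b : ℤ} (hN : 1 ≤ N) (hc : 1 ≤ c) (hNc : N * c < 4)
    (h : a ^ 2 * c + b ^ 2 * N - a * b * (N * c) = a * c) : 0 ≤ a ∧ 0 ≤ b ∧ a ≤ 2 * b + 1 := by
  have hN3 : N ≤ 3 := by nlinarith
  have hc3 : c ≤ 3 := by nlinarith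
  have hsq : (2 * N * b - N * c * a) ^ 2 + a ^ 2 * (N * c) * (4 - N * c) = 4 * a * (N * c) := by
    linear_combination (4 * N) * h
  have hM : 0 < N * c := by positivity
  have ha0 : 0 ≤ a := by
    by_contra hneg
    push Not at hneg
    have h1 : 0 ≤ a ^ 2 * (N * c) * (4 - N * c) := by
      have : 0 ≤ 4 - N * c := by omega
      positivity
    have h2 : 4 * a * (N * c) < 0 := by nlinarith
    nlinarith [sq_nonneg (2 * N * b - N * c * a)]
  have ha4 : a ≤ 4 := by
    by_contra hneg
    push Not at hneg
    have h1 : a * (N * c) * (a * (4 - N * c) - 4) ≤ 0 := by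
      nlinarith [sq_nonneg (2 * N * b - N * c * a)]
    have h2 : 0 < a * (4 - N * c) - 4 := by nlinarith
    have h3 : 0 < a * (N * c) := by positivity
    have := mul_pos h3 h2
    linarith
  have hNca : N * c * a ≤ 12 := by nlinarith
  have hNca0 : 0 ≤ N * c * a := by positivity
  have hy : |2 * N * b - N * c * a| ≤ 6 := by
    have h1 : 0 ≤ a ^ 2 * (N * c) * (4 - N * c) := by
      have : 0 ≤ 4 - N * c := by omega
      positivity
    have h2 : (2 * N * b - N * c * a) ^ 2 < 7 ^ 2 := by nlinarith
    have := abs_lt_of_sq_lt_sq h2 (by norm_num)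
    omega
  rw [abs_le] at hy
  have hb1 : -3 ≤ b := by
    by_contra hneg
    push Not at hneg
    nlinarith
  have hb2 : b ≤ 9 := by
    by_contra hneg
    push Not at hneg
    nlinarith
  clear hsq hM hNca hNca0 hy
  refine ⟨ha0, ?_⟩
  interval_cases N <;> interval_cases c <;> first
    | (exfalso; omega)
    | (interval_cases a <;> interval_cases b <;> omega)

variable {α β : E}

/-- The weights in the coset of the root lattice of `ϖ` that are as long as `ϖ`. -/
def weightSet (ϖ α β : E) : Set E :=
  {v | (∃ a b : ℤ, v = ϖ - ((a : ℝ) • β + (b : ℝ) • α)) ∧ (inner ℝ v v : ℝ) = inner ℝ ϖ ϖ}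

theorem self_mem_weightSet (ϖ α β : E) : ϖ ∈ weightSet ϖ α β :=
  ⟨⟨0, 0, by simp⟩, rfl⟩

theorem IsSimplePair.exists_inner_coroot_weight (hΦ : IsRootSystem Φ) (h : IsSimplePair Φ α β)
    {ϖ : E} (hα : (inner ℝ ϖ α : ℝ) = 0) (hβ : (inner ℝ ϖ β : ℝ) = inner ℝ β β / 2) {v : E}
    (hv : v ∈ weightSet ϖ α β) {γ : E} (hγ : γ ∈ Φ) :
    ∃ n : ℤ, (inner ℝ v (coroot γ) : ℝ) = n := by
  obtain ⟨⟨a, b, rfl⟩, -⟩ := hv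
  obtain ⟨-, -, m, -, hm⟩ := h.exists_int hΦ hα hβ hγ
  obtain ⟨i, hi⟩ := hΦ.exists_inner_coroot hγ h.right_mem
  obtain ⟨j, hj⟩ := hΦ.exists_inner_coroot hγ h.left_mem
  refine ⟨m - (a * i + b * j), ?_⟩
  rw [inner_sub_left, inner_add_left, real_inner_smul_left, real_inner_smul_left, hm, hi, hj]
  push_cast; rfl

theorem IsSimplePair.linearReflection_mem_weightSet (hΦ : IsRootSystem Φ)
    (h : IsSimplePair Φ α β) {ϖ : E} (hα : (inner ℝ ϖ α : ℝ) = 0)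
    (hβ : (inner ℝ ϖ β : ℝ) = inner ℝ β β / 2) {v : E}
    (hv : v ∈ weightSet ϖ α β) {γ : E} (hγ : γ ∈ Φ) :
    linearReflection γ v ∈ weightSet ϖ α β := by
  obtain ⟨n, hn⟩ := h.exists_inner_coroot_weight hΦ hα hβ hv hγ
  obtain ⟨⟨a, b, hv1⟩, hv2⟩ := hv
  obtain ⟨i, j, -, hij, -⟩ := h.exists_int hΦ hα hβ hγ
  refine ⟨⟨a + n * i, b + n * j, ?_⟩, ?_⟩
  · rw [linearReflection_apply', hn, hij, hv1]
    push_cast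
    module
  · rw [LinearIsometryEquiv.inner_map_map, hv2]

theorem IsSimplePair.coeff_bounds (hΦ : IsRootSystem Φ) (h : IsSimplePair Φ α β)
    {ϖ : E} (hα : (inner ℝ ϖ α : ℝ) = 0) (hβ : (inner ℝ ϖ β : ℝ) = inner ℝ β β / 2) {a b : ℤ}
    (hv : ϖ - ((a : ℝ) • β + (b : ℝ) • α) ∈ weightSet ϖ α β) :
    0 ≤ a ∧ 0 ≤ b ∧ a ≤ 2 * b + 1 := by
  have hββ : (0 : ℝ) < inner ℝ β β := real_inner_self_pos.2 (hΦ.ne_zero h.right_mem)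
  have hαα : (0 : ℝ) < inner ℝ α α := real_inner_self_pos.2 (hΦ.ne_zero h.left_mem)
  obtain ⟨c', hc'⟩ := hΦ.exists_inner_coroot h.left_mem h.right_mem
  obtain ⟨N', hN'⟩ := hΦ.exists_inner_coroot h.right_mem h.left_mem
  have hobt := h.inner_coroot_nonpos hΦ
  rw [inner_coroot_right] at hc' hN' hobt
  rw [real_inner_comm] at hN'
  set B : ℝ := inner ℝ β β with hB
  set A : ℝ := inner ℝ α α with hA
  set g : ℝ := inner ℝ β α with hg
  have hcA : 2 * g = c' * A := by rw [← hc']; field_simp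
  have hNB : 2 * g = N' * B := by rw [← hN']; field_simp
  have hg0 : g ≤ 0 := by
    by_contra hpos
    push Not at hpos
    have : 0 < 2 * g / A := by positivity
    linarith
  have hell : (a : ℝ) ^ 2 * B + (b : ℝ) ^ 2 * A + 2 * a * b * g = a * B := by
    have h1 := hv.2
    have e1 : (inner ℝ β ϖ : ℝ) = B / 2 := by rw [real_inner_comm, hβ]
    have e2 : (inner ℝ α ϖ : ℝ) = 0 := by rw [real_inner_comm, hα]
    have e3 : (inner ℝ α β : ℝ) = g := real_inner_comm β α
    simp only [inner_sub_left, inner_sub_right, inner_add_left, inner_add_right,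
      real_inner_smul_left, real_inner_smul_right, hα, hβ, e1, e2, e3, ← hB, ← hA, ← hg] at h1
    linear_combination h1
  have hcs : g ^ 2 < A * B := by
    have hne : A • β - g • α ≠ 0 := by
      intro h0
      have := h.indep A (-g) (by rw [← h0]; module)
      linarith [this.1]
    have h1 := real_inner_self_pos.2 hne
    simp only [inner_sub_left, inner_sub_right, real_inner_smul_left, real_inner_smul_right] at h1
    rw [real_inner_comm β α, ← hB, ← hA, ← hg] at h1
    have h2 : 0 < A * (A * B - g ^ 2) := by linarith
    have := pos_of_mul_pos_right h2 hαα.le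
    linarith
  have hc0 : c' ≤ 0 := by
    have : (c' : ℝ) ≤ 0 := by
      by_contra hpos
      push Not at hpos
      have : 0 < (c' : ℝ) * A := by positivity
      linarith
    exact_mod_cast this
  have hN0 : N' ≤ 0 := by
    have : (N' : ℝ) ≤ 0 := by
      by_contra hpos
      push Not at hpos
      have : 0 < (N' : ℝ) * B := by positivity
      linarith
    exact_mod_cast this
  have hprod : N' * c' < 4 := by
    have h1 : (N' : ℝ) * c' * (A * B) < 4 * (A * B) := by
      have : (N' : ℝ) * c' * (A * B) = 4 * g ^ 2 := by
        linear_combination (-2 * g) * hcA - c' * A * hNB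
      linarith
    have h2 : (N' : ℝ) * c' < 4 := lt_of_mul_lt_mul_right h1 (by positivity)
    exact_mod_cast h2
  by_cases hg00 : g = 0
  · rw [hg00] at hell
    have h1 : (a : ℝ) * (a - 1) * B ≤ 0 := by
      have : 0 ≤ (b : ℝ) ^ 2 * A := by positivity
      nlinarith
    have h2 : (a : ℝ) * (a - 1) ≤ 0 := by
      by_contra hpos
      push Not at hpos
      have := mul_pos hpos hββ
      linarith
    have h3 : a * (a - 1) ≤ 0 := by exact_mod_cast h2
    have h4 : 0 ≤ a := by nlinarith
    have h5 : a ≤ 1 := by nlinarith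
    have h6 : (b : ℝ) ^ 2 * A = 0 := by
      rcases (by omega : a = 0 ∨ a = 1) with rfl | rfl <;> · push_cast at hell; linarith
    have h7 : (b : ℝ) = 0 := by
      rcases mul_eq_zero.1 h6 with h | h
      · exact pow_eq_zero_iff two_ne_zero |>.1 h
      · linarith
    have h8 : b = 0 := by exact_mod_cast h7
    omega
  · have hc1 : c' ≠ 0 := by
      rintro rfl
      push_cast at hcA
      apply hg00; linarith
    have hN1 : N' ≠ 0 := by
      rintro rfl
      push_cast at hNB
      apply hg00; linarith
    refine int_ellipse_bounds (N := -N') (c := -c') (by omega) (by omega) (by linarith) ?_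
    have h1 : ((a : ℝ) ^ 2 * (-c') + (b : ℝ) ^ 2 * (-N') - a * b * (N' * c')) * B
        = a * (-c') * B := by
      linear_combination (-c' : ℝ) * hell + (c' * a * b + b ^ 2) * hNB - b ^ 2 * hcA
    have h2 := mul_right_cancel₀ hββ.ne' h1
    have h3 : a ^ 2 * (-c') + b ^ 2 * (-N') - a * b * (N' * c') = a * (-c') := by
      exact_mod_cast h2
    linarith

/-- The roots on the same side of the line spanned by `α` as the fundamental weight. -/
theorem IsSimplePair.root_coeff_bounds (hΦ : IsRootSystem Φ) (h : IsSimplePair Φ α β)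
    {ϖ : E} (hα : (inner ℝ ϖ α : ℝ) = 0) (hβ : (inner ℝ ϖ β : ℝ) = inner ℝ β β / 2) {γ : E}
    (hγ : γ ∈ Φ) (hpos : 0 < (inner ℝ ϖ γ : ℝ)) :
    ∃ a b : ℤ, γ = (a : ℝ) • β + (b : ℝ) • α ∧ 1 ≤ a ∧ 0 ≤ b ∧ a ≤ 2 * b + 1 := by
  obtain ⟨a, b, m, hab, hm⟩ := h.exists_int hΦ hα hβ hγ
  have hγγ : (0 : ℝ) < inner ℝ γ γ := real_inner_self_pos.2 (hΦ.ne_zero hγ)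
  have hββ : (0 : ℝ) < inner ℝ β β := real_inner_self_pos.2 (hΦ.ne_zero h.right_mem)
  have hm0 : (0 : ℝ) < m := by
    rw [← hm, inner_coroot_right]; positivity
  have hm1 : 0 < m := by exact_mod_cast hm0
  have hmem := h.linearReflection_mem_weightSet hΦ hα hβ (self_mem_weightSet ϖ α β) hγ
  have heq : linearReflection γ ϖ
      = ϖ - (((m * a : ℤ) : ℝ) • β + ((m * b : ℤ) : ℝ) • α) := by
    rw [linearReflection_apply', hm]
    nth_rewrite 1 [hab]
    push_cast
    module
  rw [heq] at hmem
  obtain ⟨h1, h2, h3⟩ := h.coeff_bounds hΦ hα hβ hmem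
  have ha0 : (0 : ℝ) < a := by
    have : (inner ℝ ϖ γ : ℝ) = a * (inner ℝ β β / 2) := by
      rw [hab, inner_add_right, real_inner_smul_right, real_inner_smul_right, hα, hβ]; ring
    rw [this] at hpos
    exact pos_of_mul_pos_left hpos (by positivity)
  have ha1 : 0 < a := by exact_mod_cast ha0
  refine ⟨a, b, hab, ha1, nonneg_of_mul_nonneg_right h2 hm1, ?_⟩
  by_contra hcon
  push Not at hcon
  nlinarith

/-! ### A Bruhat monotone bound -/

theorem exists_bruhatStep_level_lt (hΦ : IsRootSystem Φ) {p : E} (hp : p ∈ regularPoints Φ)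
    {x y : affineWeylGroup Φ} (h : BruhatStep Φ p x y) :
    ∃ (γ : E) (hγ : γ ∈ Φ) (k : ℤ), y = mkReflection hγ k * x ∧
      level γ p < k ∧ level γ ((x : Equiv.Perm E) p) < k := by
  obtain ⟨γ, hγ, k, hy, hsep⟩ := h
  rcases not_separates_cases hγ hp (smul_mem_regularPoints hΦ x hp) hsep with h | h
  · exact ⟨γ, hγ, k, hy, h⟩
  · exact ⟨-γ, hΦ.neg_mem hγ, -k, by rw [hy, mkReflection_neg hΦ hγ], h⟩

theorem IsSimplePair.exists_weight_of_bruhatLE (hΦ : IsRootSystem Φ) (h : IsSimplePair Φ α β)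
    {ϖ : E} (hα : (inner ℝ ϖ α : ℝ) = 0) (hβ : (inner ℝ ϖ β : ℝ) = inner ℝ β β / 2) {p : E}
    (hp : p ∈ regularPoints Φ) {x u : affineWeylGroup Φ} (hxu : BruhatLE Φ p x u) :
    ∀ v ∈ weightSet ϖ α β, ∃ v' ∈ weightSet ϖ α β,
      (inner ℝ ((x : Equiv.Perm E) p) v : ℝ)
        ≤ inner ℝ ((u : Equiv.Perm E) p) v' - ⌈(inner ℝ p (v' - v) : ℝ)⌉ := by
  induction hxu using Relation.ReflTransGen.head_induction_on with
  | refl => exact fun v hv => ⟨v, hv, by simp⟩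
  | head hstep _ ih =>
    rename_i x z _
    intro v hv
    obtain ⟨γ, hγ, k, hz, hlp, hlx⟩ := exists_bruhatStep_level_lt hΦ hp hstep
    rw [level_lt_iff] at hlp hlx
    obtain ⟨n, hn⟩ := h.exists_inner_coroot_weight hΦ hα hβ hv hγ
    set X := (x : Equiv.Perm E) p
    have hzX : (z : Equiv.Perm E) p = X - (inner ℝ X γ - (k : ℝ)) • coroot γ := by
      rw [hz]; rfl
    have hzv : (inner ℝ ((z : Equiv.Perm E) p) v : ℝ)
        = inner ℝ X v - (inner ℝ X γ - k) * n := by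
      rw [hzX, inner_sub_left, real_inner_smul_left, real_inner_comm v (coroot γ), hn]
    by_cases hn0 : 0 ≤ n
    · obtain ⟨v', hv', hle⟩ := ih v hv
      refine ⟨v', hv', le_trans ?_ hle⟩
      rw [hzv]
      have : (0 : ℝ) ≤ n := by exact_mod_cast hn0
      nlinarith
    · have hn1 : (n : ℝ) ≤ 0 := by
        have : n ≤ 0 := by omega
        exact_mod_cast this
      obtain ⟨v', hv', hle⟩ := ih _ (h.linearReflection_mem_weightSet hΦ hα hβ hv hγ)
      refine ⟨v', hv', ?_⟩
      have hzγ : (inner ℝ ((z : Equiv.Perm E) p) γ : ℝ) = 2 * k - inner ℝ X γ := by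
        rw [hzX, inner_sub_left, real_inner_smul_left, real_inner_comm γ (coroot γ),
          inner_self_coroot (hΦ.ne_zero hγ)]
        ring
      have hrefl : linearReflection γ v = v - (n : ℝ) • γ := by
        rw [linearReflection_apply', hn]
      rw [hrefl, inner_sub_right, real_inner_smul_right, hzv, hzγ] at hle
      have hceil : ⌈(inner ℝ p (v' - v) : ℝ)⌉ ≤ ⌈(inner ℝ p (v' - (v - (n : ℝ) • γ)) : ℝ)⌉
          + (-(n * k)) := by
        rw [← Int.ceil_add_intCast]
        apply Int.ceil_le_ceil
        simp only [inner_sub_right, real_inner_smul_right]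
        push_cast
        nlinarith
      have hceil' : (⌈(inner ℝ p (v' - v) : ℝ)⌉ : ℝ)
          ≤ ⌈(inner ℝ p (v' - (v - (n : ℝ) • γ)) : ℝ)⌉ - n * k := by
        have := (Int.cast_le (R := ℝ)).2 hceil
        push_cast at this
        linarith
      linarith

end SimplePair

section Annex

variable {E : Type*} [NormedAddCommGroup E] [InnerProductSpace ℝ E] {Φ : Set E}

/-! ### Products of parallel reflections -/

theorem affineReflection_comp {α : E} (hα : α ≠ 0) (a b : ℝ) (x : E) :
    affineReflection α b (affineReflection α a x) = x + (b - a) • coroot α := by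
  have h : (inner ℝ (coroot α) α : ℝ) = 2 := by rw [real_inner_comm, inner_self_coroot hα]
  simp only [affineReflection_apply, inner_sub_left, real_inner_smul_left, h]
  module

theorem conj_mkReflection_self (hΦ : IsRootSystem Φ) {α : E} (hα : α ∈ Φ) (a j : ℤ) :
    mkReflection hα a * mkReflection hα j * (mkReflection hα a)⁻¹
      = mkReflection hα (2 * a - j) := by
  have h : (inner ℝ (coroot α) α : ℝ) = 2 := by
    rw [real_inner_comm, inner_self_coroot (hΦ.ne_zero hα)]
  rw [mul_inv_eq_iff_eq_mul]
  apply Subtype.ext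
  ext x
  simp only [Subgroup.coe_mul, Equiv.Perm.mul_apply, coe_mkReflection,
    affineReflection_comp (hΦ.ne_zero hα)]
  push_cast
  module

theorem inner_affineReflection_of_orthogonal {α v : E} (h : (inner ℝ v α : ℝ) = 0) (a : ℝ)
    (x : E) : (inner ℝ (affineReflection α a x) v : ℝ) = inner ℝ x v := by
  rw [affineReflection_apply, coroot, inner_sub_left, real_inner_smul_left, real_inner_smul_left,
    real_inner_comm v α, h]
  ring

/-- Glide reflections are not reflections. -/
theorem eq_or_eq_neg_of_glide (hΦ : IsRootSystem Φ) {α γ δ : E} (hα : α ∈ Φ) (hγ : γ ∈ Φ)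
    (hδ : δ ∈ Φ) {a b k l : ℤ} (hab : a ≠ b)
    (h : mkReflection hα b * mkReflection hα a * mkReflection hγ k = mkReflection hδ l) :
    α = γ ∨ α = -γ := by
  have key : ∀ x : E, x - ((inner ℝ x γ : ℝ) - k) • coroot γ + ((b : ℝ) - a) • coroot α
      = x - ((inner ℝ x δ : ℝ) - l) • coroot δ := by
    intro x
    have := congrArg (fun g : affineWeylGroup Φ => (g : Equiv.Perm E) x) h
    simp only [Subgroup.coe_mul, Equiv.Perm.mul_apply, coe_mkReflection,
      affineReflection_comp (hΦ.ne_zero hα)] at this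
    exact this
  have h0 := key 0
  simp only [inner_zero_left] at h0
  have h1 := key δ
  have h2 : (inner ℝ δ γ : ℝ) • coroot γ = (inner ℝ δ δ : ℝ) • coroot δ := by
    rw [← sub_eq_zero] at h0 h1 ⊢
    rw [← h0, ← sub_eq_zero, ← neg_eq_zero, ← h1]
    module
  have hδδ : (inner ℝ δ δ : ℝ) ≠ 0 := inner_self_ne_zero.mpr (hΦ.ne_zero hδ)
  have h3 : δ = ((inner ℝ δ γ : ℝ) / inner ℝ γ γ) • γ := by
    rw [coroot, coroot, smul_smul, smul_smul, mul_div_cancel₀ _ hδδ] at h2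
    calc δ = (1 / 2 : ℝ) • ((2 : ℝ) • δ) := by rw [smul_smul]; norm_num
      _ = _ := by
        rw [← h2, smul_smul]
        congr 1
        ring
  have h5 : ∃ c : ℝ, coroot α = c • coroot γ := by
    have hba : ((b : ℝ) - a) ≠ 0 := by
      rw [sub_ne_zero]; exact_mod_cast hab.symm
    have h6 : ∃ e : ℝ, coroot δ = e • coroot γ := by
      rcases hΦ.eq_or_eq_neg hγ hδ h3 with h | h
      · exact ⟨1, by rw [h, one_smul]⟩
      · exact ⟨-1, by rw [h, coroot_neg, neg_one_smul]⟩
    obtain ⟨e, he⟩ := h6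
    refine ⟨((b : ℝ) - a)⁻¹ * (l * e - k), ?_⟩
    rw [mul_smul, eq_inv_smul_iff₀ hba]
    rw [he] at h0
    rw [← sub_eq_zero] at h0 ⊢
    rw [← h0]
    module
  obtain ⟨c, hc⟩ := h5
  have hαα : (inner ℝ α α : ℝ) ≠ 0 := inner_self_ne_zero.mpr (hΦ.ne_zero hα)
  have h7 : α = (inner ℝ α α / 2 * c * (2 / inner ℝ γ γ) : ℝ) • γ := by
    rw [mul_smul, ← coroot, mul_smul, ← hc, coroot, smul_smul]
    have : (inner ℝ α α / 2 * (2 / inner ℝ α α) : ℝ) = 1 := by field_simp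
    rw [this, one_smul]
  exact hΦ.eq_or_eq_neg hγ hα h7

/-! ### Reflections that increase the length by one -/

theorem length_mkReflection_mul_eq (hE : Module.finrank ℝ E = 2) (hΦ : IsRootSystem Φ) {p : E}
    (hp : p ∈ regularPoints Φ) {α : E} (hα : α ∈ Φ) {a : ℤ} {x : affineWeylGroup Φ}
    (h : length (simpleReflections Φ (alcove Φ p)) (mkReflection hα a * x)
      = length (simpleReflections Φ (alcove Φ p)) x + 1) :
    |level α ((mkReflection hα a * x : affineWeylGroup Φ).1 p) - level α p|
        = |level α (x.1 p) - level α p| + 1 ∧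
      ∀ β ∈ Φ, β ≠ α → β ≠ -α →
        pairDist α β ((mkReflection hα a * x : affineWeylGroup Φ).1 p) p
          = pairDist α β (x.1 p) p := by
  have h1 := not_separates_of_length_lt hE hΦ hp hα (k := a) (x := x) (by omega)
  refine (wallDist_reflection hΦ hα (a := a) (smul_mem_regularPoints hΦ x hp) hp
    fun h' => h1 h'.symm).2 ?_
  rw [← coe_mkReflection hα, ← coe_mul_apply, wallDist_eq_length hE hΦ hp,
    wallDist_eq_length hE hΦ hp, h]
  push_cast
  ring

theorem level_mul_eq_or (hE : Module.finrank ℝ E = 2) (hΦ : IsRootSystem Φ) {p : E}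
    (hp : p ∈ regularPoints Φ) {s : affineWeylGroup Φ}
    (hs : s ∈ simpleReflections Φ (alcove Φ p)) (x : affineWeylGroup Φ) {δ : E} (hδ : δ ∈ Φ)
    (h : level δ ((x * s : affineWeylGroup Φ).1 p) ≠ level δ (x.1 p)) :
    x * s * x⁻¹
      = mkReflection hδ (max (level δ ((x * s : affineWeylGroup Φ).1 p)) (level δ (x.1 p))) := by
  symm
  apply mkReflection_eq_of_separates hE hΦ hp hs
  unfold Separates
  omega

theorem AdjacentParallel.exists_mkReflection (hE : Module.finrank ℝ E = 2)
    (hΦ : IsRootSystem Φ) {α : E} (hα : α ∈ Φ) {a : ℤ} {r : affineWeylGroup Φ}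
    (hr : IsReflection Φ r) (h : AdjacentParallel Φ (mkReflection hα a) r) :
    ∃ b : ℤ, r = mkReflection hα b ∧ (b = a + 1 ∨ a = b + 1) := by
  obtain ⟨hpar, hne, hbetw⟩ := h
  have hα0 := hΦ.ne_zero hα
  have hex : ∃ b : ℤ, r = mkReflection hα b := by
    obtain ⟨δ, hδ, l, rfl⟩ := isReflection_iff.1 hr
    rw [wall_mkReflection hΦ, wall_mkReflection hΦ] at hpar
    rcases hΦ.eq_or_eq_neg_of_parallel hE hα hδ hpar with rfl | rfl
    · exact ⟨l, rfl⟩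
    · refine ⟨-l, ?_⟩
      rw [← mkReflection_neg hΦ hα (-l)]
      congr 1
      ring
  obtain ⟨b, rfl⟩ := hex
  refine ⟨b, rfl, ?_⟩
  have hab : a ≠ b := by
    rintro rfl
    exact hne rfl
  by_contra hcon
  push Not at hcon
  rw [wall_mkReflection hΦ, wall_mkReflection hΦ] at hbetw
  rcases lt_or_gt_of_ne hab with hlt | hlt
  · refine hbetw (mkReflection hα (a + 1)) ⟨α, hα, _, rfl⟩ ?_ ?_
    · rw [wall_mkReflection hΦ]
      exact hyperplane_parallel hα0 _ _
    · intro x hx y hy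
      rw [wall_mkReflection hΦ]
      refine hyperplane_sOppSide ?_ ?_
      · rw [mem_hyperplane.1 hx]
        exact_mod_cast lt_add_one a
      · rw [mem_hyperplane.1 hy]
        have : a + 1 < b := by omega
        exact_mod_cast this
  · refine hbetw (mkReflection hα (b + 1)) ⟨α, hα, _, rfl⟩ ?_ ?_
    · rw [wall_mkReflection hΦ]
      exact hyperplane_parallel hα0 _ _
    · intro x hx y hy
      rw [wall_mkReflection hΦ]
      refine (hyperplane_sOppSide ?_ ?_).symm
      · rw [mem_hyperplane.1 hy]
        exact_mod_cast lt_add_one b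
      · rw [mem_hyperplane.1 hx]
        have : b + 1 < a := by omega
        exact_mod_cast this

/-- If the wall between `w * s` and `w` is parallel to `H_{α,a}`, and `H_{α,a}` is adjacent to the
strip of `w`, then the reflection in `H_{α,a}` changes the length of `w * s` by more than one. -/
theorem length_ne_of_parallel (hE : Module.finrank ℝ E = 2) (hΦ : IsRootSystem Φ) {p : E}
    (hp : p ∈ regularPoints Φ) {w s : affineWeylGroup Φ}
    (hs : s ∈ simpleReflections Φ (alcove Φ p))
    (hws : length (simpleReflections Φ (alcove Φ p)) w
      = length (simpleReflections Φ (alcove Φ p)) (w * s) + 1)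
    {α : E} (hα : α ∈ Φ) {a : ℤ}
    (hlev : level α ((w * s : affineWeylGroup Φ).1 p) < level α (w.1 p))
    (hne : mkReflection hα a * (w * s) ≠ w)
    (hbetween : ∀ q : affineWeylGroup Φ, IsReflection Φ q →
      (wall Φ q).Parallel (wall Φ (mkReflection hα a)) →
      ¬ WallBetween Φ q (w.1 '' alcove Φ p) (wall Φ (mkReflection hα a))) :
    length (simpleReflections Φ (alcove Φ p)) (mkReflection hα a * (w * s))
      ≠ length (simpleReflections Φ (alcove Φ p)) (w * s) + 1 := by
  intro hlen
  have hα0 := hΦ.ne_zero hα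
  set k := level α (w.1 p) with hk
  set X := level α ((w * s : affineWeylGroup Φ).1 p) with hX
  have hss : w * s * s = w := by
    nth_rewrite 2 [← inv_of_mem_simpleReflections hs]
    group
  have hq : w * s * w⁻¹ = mkReflection hα k := by
    rw [level_mul_eq_or hE hΦ hp hs w hα hlev.ne]
    congr 1
    omega
  have hqw : mkReflection hα k * (w * s) = w := by
    rw [← hq]
    calc w * s * w⁻¹ * (w * s) = w * s * s := by group
      _ = w := hss
  have hXk : X = k - 1 := by
    have h1 : (mkReflection hα k * (w * s) : affineWeylGroup Φ).1 p = w.1 p := by rw [hqw]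
    have h2 := level_self_mkReflection hΦ hα k (smul_mem_regularPoints hΦ (w * s) hp)
    rw [← coe_mkReflection hα, ← coe_mul_apply, h1] at h2
    change k = 2 * k - 1 - X at h2
    omega
  have hZ := (length_mkReflection_mul_eq hE hΦ hp hα (a := k) (x := w * s)
    (by rw [hqw, hws])).1
  rw [hqw] at hZ
  have hD := (length_mkReflection_mul_eq hE hΦ hp hα hlen).1
  have hr := level_self_mkReflection hΦ hα a (smul_mem_regularPoints hΦ (w * s) hp)
  rw [← coe_mkReflection hα, ← coe_mul_apply] at hr
  rw [hr] at hD
  have hak : a ≠ k := by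
    rintro rfl
    exact hne hqw
  have himg : ∀ x ∈ w.1 '' alcove Φ p, (k : ℝ) < inner ℝ x α ∧ (inner ℝ x α : ℝ) < k + 1 := by
    rintro _ ⟨y, hy, rfl⟩
    obtain ⟨L, -, g2, -, g4⟩ := exists_level_smul hΦ w
    obtain ⟨n, -, hn⟩ := g4 α hα
    have h1 : level α (w.1 y) = k := by
      rw [hk, hn, hn, level_eq_of_mem_alcove hΦ hp hy (g2 α hα)]
    have hyr := smul_mem_regularPoints hΦ w (alcove_subset_regularPoints hΦ hp hy)
    rw [← h1]
    exact ⟨(lt_level_iff hyr hα _).1 le_rfl, inner_lt_level _ _⟩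
  rw [wall_mkReflection hΦ] at hbetween
  have hak' : a = k + 1 := by
    by_contra hcon
    rcases (by omega : a < k ∨ k + 1 < a) with h | h
    · refine hbetween (mkReflection hα k) ⟨α, hα, _, rfl⟩ ?_ ?_
      · rw [wall_mkReflection hΦ]
        exact hyperplane_parallel hα0 _ _
      · intro x hx y hy
        rw [wall_mkReflection hΦ]
        refine (hyperplane_sOppSide ?_ (himg x hx).1).symm
        rw [mem_hyperplane.1 hy]
        exact_mod_cast h
    · refine hbetween (mkReflection hα (k + 1)) ⟨α, hα, _, rfl⟩ ?_ ?_
      · rw [wall_mkReflection hΦ]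
        exact hyperplane_parallel hα0 _ _
      · intro x hx y hy
        rw [wall_mkReflection hΦ]
        refine hyperplane_sOppSide (by push_cast; exact (himg x hx).2) ?_
        rw [mem_hyperplane.1 hy]
        exact_mod_cast h
  change |2 * a - 1 - X - level α p| = |X - level α p| + 1 at hD
  change |k - level α p| = |X - level α p| + 1 at hZ
  simp only [abs_eq_max_neg] at hD hZ
  omega

/-! ### The sector of an alcove -/

theorem le_level_add_smul {α β : E} {a b : ℤ} (ha : 0 ≤ a) (hb : 0 ≤ b) (x : E) :
    a * level β x + b * level α x ≤ level ((a : ℝ) • β + (b : ℝ) • α) x := by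
  rw [level, level, level, Int.le_floor, inner_add_right, real_inner_smul_right,
    real_inner_smul_right]
  push_cast
  have ha' : (0 : ℝ) ≤ a := by exact_mod_cast ha
  have hb' : (0 : ℝ) ≤ b := by exact_mod_cast hb
  exact add_le_add (mul_le_mul_of_nonneg_left (Int.floor_le _) ha')
    (mul_le_mul_of_nonneg_left (Int.floor_le _) hb')

theorem level_add_smul_lt {α β : E} {a b : ℤ} (ha : 0 ≤ a) (hb : 0 ≤ b) (hab : 0 < a + b)
    (x : E) :
    level ((a : ℝ) • β + (b : ℝ) • α) x < a * level β x + b * level α x + a + b := by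
  rw [level_lt_iff, inner_add_right, real_inner_smul_right, real_inner_smul_right]
  push_cast
  have ha' : (0 : ℝ) ≤ a := by exact_mod_cast ha
  have hb' : (0 : ℝ) ≤ b := by exact_mod_cast hb
  have h1 := inner_lt_level x β
  have h2 := inner_lt_level x α
  rcases ha.eq_or_lt with rfl | ha
  · have : (0 : ℝ) < b := by
      have : 0 < b := by omega
      exact_mod_cast this
    push_cast
    nlinarith
  · have : (0 : ℝ) < a := by exact_mod_cast ha
    nlinarith

/-- If two reflections in adjacent hyperplanes orthogonal to `α` both increase the length by one,
and the alcove reached is far from the base alcove in the direction of `α`, then it is in a sector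
that is bounded by a hyperplane orthogonal to a simple root next to `α`. -/
theorem exists_isSimplePair_level_le (hE : Module.finrank ℝ E = 2) (hΦ : IsRootSystem Φ) {p : E}
    (hp : p ∈ regularPoints Φ) {α : E} (hα : α ∈ Φ) {a b : ℤ} (hab : b = a + 1 ∨ a = b + 1)
    {x : affineWeylGroup Φ}
    (h₁ : length (simpleReflections Φ (alcove Φ p)) (mkReflection hα a * x)
      = length (simpleReflections Φ (alcove Φ p)) x + 1)
    (h₂ : length (simpleReflections Φ (alcove Φ p)) (mkReflection hα b * (mkReflection hα a * x))
      = length (simpleReflections Φ (alcove Φ p)) (mkReflection hα a * x) + 1)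
    (hD : level α p + 3
      ≤ level α ((mkReflection hα b * (mkReflection hα a * x) : affineWeylGroup Φ).1 p)) :
    ∃ β, IsSimplePair Φ α β ∧ level β p
      ≤ level β ((mkReflection hα b * (mkReflection hα a * x) : affineWeylGroup Φ).1 p) := by
  have hα0 := hΦ.ne_zero hα
  set y := mkReflection hα b * (mkReflection hα a * x) with hy
  obtain ⟨d1, e1⟩ := length_mkReflection_mul_eq hE hΦ hp hα h₁
  obtain ⟨d2, e2⟩ := length_mkReflection_mul_eq hE hΦ hp hα h₂
  rw [← hy] at d2 e2
  have hyx : y.1 p = x.1 p + ((b : ℝ) - a) • coroot α := affineReflection_comp hα0 a b (x.1 p)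
  have hlev : ∀ (δ : E) (n : ℤ), (inner ℝ δ (coroot α) : ℝ) = n →
      level δ (y.1 p) = level δ (x.1 p) + (b - a) * n := by
    intro δ n hn
    rw [level, hyx, inner_add_left, real_inner_smul_left, real_inner_comm δ (coroot α), hn]
    have : ((b : ℝ) - a) * n = (((b - a) * n : ℤ) : ℝ) := by push_cast; ring
    rw [this, Int.floor_add_intCast, level]
  have hαy := hlev α 2 (by rw [inner_self_coroot hα0]; norm_num)
  have hba : b - a = 1 := by
    simp only [abs_eq_max_neg] at d1 d2
    omega
  rw [hba, one_mul] at hαy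
  obtain ⟨β, hβ⟩ := hΦ.exists_isSimplePair hE hα
  obtain ⟨c', hc'⟩ := hΦ.exists_inner_coroot hα hβ.right_mem
  obtain ⟨c, rfl⟩ : ∃ c, c' = -c := ⟨-c', by ring⟩
  have hc0 : 0 ≤ c := by
    have := hβ.inner_coroot_nonpos hΦ
    rw [hc'] at this
    have : -c ≤ 0 := by exact_mod_cast this
    omega
  set β' := linearReflection α β with hβ'
  have hβ'eq : β' = ((1 : ℤ) : ℝ) • β + (c : ℝ) • α := by
    rw [hβ', linearReflection_apply', hc']
    push_cast
    module
  have hc'' : (inner ℝ β' (coroot α) : ℝ) = c := by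
    rw [hβ'eq, inner_add_left, real_inner_smul_left, real_inner_smul_left, hc',
      inner_self_coroot hα0]
    push_cast
    ring
  have hβ'mem : β' ∈ Φ := hΦ.linearReflection_mem hα hβ.right_mem
  have l1 := hlev β (-c) hc'
  have l2 := hlev β' c hc''
  rw [hba, one_mul] at l1 l2
  have hpair := (e2 β hβ.right_mem hβ.right_ne.1 hβ.right_ne.2).trans
    (e1 β hβ.right_mem hβ.right_ne.1 hβ.right_ne.2)
  unfold pairDist at hpair
  rw [← hβ', l1, l2] at hpair
  have b1 := le_level_add_smul (α := α) (β := β) zero_le_one hc0 (y.1 p)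
  rw [← hβ'eq] at b1
  have b2 : level β' p ≤ level β p + c * (level α p + 1) := by
    have := level_linearReflection_le hc' (by omega : -c ≤ 0) (a := level α p + 1) (p := p)
      (by omega)
    rw [← hβ'] at this
    linarith
  have b3 : c * (level α p + 3) ≤ c * level α (y.1 p) := mul_le_mul_of_nonneg_left hD hc0
  have b4 : c = 0 → β' = β := by
    rintro rfl
    rw [hβ'eq]
    push_cast
    module
  by_cases hA : level β p ≤ level β (y.1 p)
  · exact ⟨β, hβ, hA⟩
  · refine ⟨-β', hβ.mirror hΦ, ?_⟩
    rw [level_neg hp hβ'mem, level_neg (smul_mem_regularPoints hΦ y hp) hβ'mem]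
    have b5 : level β p + 2 * c + level β' (y.1 p) ≥ level β' p + level β (y.1 p) := by nlinarith
    rcases hc0.eq_or_lt with h0 | h0
    · rw [b4 h0.symm]; omega
    · have b6 : level β' (y.1 p) - level β' p - (level β (y.1 p) - level β p) ≥ 2 * c := by
        linarith
      simp only [abs_eq_max_neg] at hpair
      omega

/-- The main step: an alcove `u` in a sector bounded by a wall orthogonal to a simple root, with
`u * s` above `u`, is not above any alcove `w` at the same height as `u * s`. -/
theorem not_bruhatLE_of_sector (hE : Module.finrank ℝ E = 2) (hΦ : IsRootSystem Φ) {p : E}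
    (hp : p ∈ regularPoints Φ) {α β : E} (hβ : IsSimplePair Φ α β) {w u s : affineWeylGroup Φ}
    (hs : s ∈ simpleReflections Φ (alcove Φ p))
    (hus : length (simpleReflections Φ (alcove Φ p)) (u * s)
      = length (simpleReflections Φ (alcove Φ p)) u + 1)
    (hne : ∀ j, u * s * u⁻¹ ≠ mkReflection hβ.left_mem j)
    (hlevα : level α p + 3 ≤ level α ((u * s : affineWeylGroup Φ).1 p))
    (hlevβ : level β p ≤ level β ((u * s : affineWeylGroup Φ).1 p))
    (hw : ∀ v, (inner ℝ v α : ℝ) = 0 →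
      (inner ℝ (w.1 p) v : ℝ) = inner ℝ ((u * s : affineWeylGroup Φ).1 p) v) :
    ¬ BruhatLE Φ p w u := by
  intro hle
  set y := u * s with hy
  have hur := smul_mem_regularPoints hΦ u hp
  have hyr := smul_mem_regularPoints hΦ y hp
  obtain ⟨ϖ, hϖα, hϖβ⟩ := hβ.exists_weight hE hΦ
  have hββ : (0 : ℝ) < inner ℝ β β := real_inner_self_pos.2 (hΦ.ne_zero hβ.right_mem)
  have hϖ0 : ϖ ≠ 0 := by
    rintro rfl
    rw [inner_zero_left] at hϖβ
    linarith
  have hαu : level α (u.1 p) = level α (y.1 p) := by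
    by_contra h
    exact hne _ (level_mul_eq_or hE hΦ hp hs u hβ.left_mem (Ne.symm h))
  have hβu : level β p ≤ level β (u.1 p) := by
    by_contra h
    push Not at h
    have h1 : mkReflection hβ.right_mem (level β p) = u * s * u⁻¹ :=
      mkReflection_eq_of_separates hE hΦ hp hs hβ.right_mem (Or.inl ⟨h, hlevβ⟩)
    have h2 : mkReflection hβ.right_mem (level β p) * u = y := by rw [h1, hy]; group
    refine not_separates_of_length_lt hE hΦ hp hβ.right_mem (k := level β p) (x := u) ?_ ?_
    · rw [h2]; omega
    · exact Or.inr ⟨h, le_rfl⟩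
  -- the wall between `u` and `y`
  have hstep : BruhatStep Φ p u y := by
    obtain ⟨γ, hγ, k, h1, -⟩ := exists_wall_smul hE hΦ hp hs u
    have h2 : y = mkReflection hγ k * u := by rw [← h1, hy]; group
    refine ⟨γ, hγ, k, h2, not_separates_of_length_lt hE hΦ hp hγ ?_⟩
    rw [← h2]; omega
  obtain ⟨γ, hγ, k, hyγ, hpk, huk⟩ := exists_bruhatStep_level_lt hΦ hp hstep
  have hyp : y.1 p = affineReflection γ k (u.1 p) := by rw [hyγ]; rfl
  have hlevy : level γ (y.1 p) = 2 * k - 1 - level γ (u.1 p) := by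
    rw [hyp, level_self_mkReflection hΦ hγ k hur]
  have hconj : u * s * u⁻¹ = mkReflection hγ k := by rw [← hy, hyγ]; group
  have hγα1 : γ ≠ α := by
    rintro rfl
    exact hne k hconj
  have hγα2 : γ ≠ -α := by
    rintro rfl
    apply hne (-k)
    rw [hconj, ← mkReflection_neg hΦ hβ.left_mem (-k)]
    congr 1
    ring
  have hϖγ := hΦ.inner_ne_zero_of_orthogonal hE hϖ0 hβ.left_mem hγ hϖα hγα1 hγα2
  have hϖγpos : 0 < (inner ℝ ϖ γ : ℝ) := by
    by_contra hneg
    have h1 : 0 < (inner ℝ ϖ (-γ) : ℝ) := by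
      rw [inner_neg_right]
      push Not at hneg
      linarith [lt_of_le_of_ne hneg hϖγ]
    obtain ⟨a, b, hab, ha, hb, hab'⟩ := hβ.root_coeff_bounds hΦ hϖα hϖβ (hΦ.neg_mem hγ) h1
    have h2 := le_level_add_smul (α := α) (β := β) (by omega : 0 ≤ a) hb (y.1 p)
    have h3 := level_add_smul_lt (α := α) (β := β) (by omega : 0 ≤ a) hb (by omega) p
    rw [← hab] at h2 h3
    rw [level_neg hyr hγ] at h2
    rw [level_neg hp hγ] at h3
    have h4 : a * level β p ≤ a * level β (y.1 p) := mul_le_mul_of_nonneg_left hlevβ (by omega)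
    have h5 : b * (level α p + 3) ≤ b * level α (y.1 p) := mul_le_mul_of_nonneg_left hlevα hb
    linarith
  have hhigher : (inner ℝ (u.1 p) ϖ : ℝ) < inner ℝ (y.1 p) ϖ := by
    have hγγ : (0 : ℝ) < inner ℝ γ γ := real_inner_self_pos.2 (hΦ.ne_zero hγ)
    rw [hyp, affineReflection_apply, coroot, inner_sub_left, real_inner_smul_left,
      real_inner_smul_left, real_inner_comm ϖ γ]
    have h1 := (level_lt_iff k).1 huk
    have h2 : 0 < (k - (inner ℝ (u.1 p) γ : ℝ)) * (2 / inner ℝ γ γ * inner ℝ ϖ γ) := by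
      apply mul_pos (by linarith)
      positivity
    linarith
  obtain ⟨v, hv, hbound⟩ := hβ.exists_weight_of_bruhatLE hΦ hϖα hϖβ hp hle ϖ
    (self_mem_weightSet ϖ α β)
  obtain ⟨a, b, hvab⟩ := hv.1
  rw [hvab] at hv hbound
  obtain ⟨ha, hb, hab⟩ := hβ.coeff_bounds hΦ hϖα hϖβ hv
  have h6 : ϖ - ((a : ℝ) • β + (b : ℝ) • α) - ϖ = -((a : ℝ) • β + (b : ℝ) • α) := by abel
  rw [h6, inner_neg_right, Int.ceil_neg, inner_sub_right] at hbound
  have h7 : level ((a : ℝ) • β + (b : ℝ) • α) p ≤ level ((a : ℝ) • β + (b : ℝ) • α) (u.1 p) := by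
    rcases (by omega : (a = 0 ∧ b = 0) ∨ 0 < a + b) with ⟨rfl, rfl⟩ | hpos
    · simp [level]
    · have h2 := le_level_add_smul (α := α) (β := β) ha hb (u.1 p)
      have h3 := level_add_smul_lt (α := α) (β := β) ha hb hpos p
      have h4 : a * level β p ≤ a * level β (u.1 p) := mul_le_mul_of_nonneg_left hβu ha
      rw [← hαu] at hlevα
      have h5 : b * (level α p + 3) ≤ b * level α (u.1 p) := mul_le_mul_of_nonneg_left hlevα hb
      rcases hb.eq_or_lt with rfl | hb
      · rcases (by omega : a = 1) with rfl
        push_cast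
        simp only [one_smul, zero_smul, add_zero]
        exact hβu
      · linarith
  have h8 : ((level ((a : ℝ) • β + (b : ℝ) • α) p : ℤ) : ℝ)
      ≤ inner ℝ (u.1 p) ((a : ℝ) • β + (b : ℝ) • α) :=
    ((Int.cast_le (R := ℝ)).2 h7).trans (level_le_inner _ _)
  rw [hw ϖ hϖα] at hbound
  unfold level at h8
  push_cast at hbound
  linarith

/-! ### Chains of reflections in parallel hyperplanes -/

theorem revProd_succ_mul (r : ℕ → affineWeylGroup Φ) (t : ℕ) (x : affineWeylGroup Φ) :
    revProd r (t + 1) * x = r (t + 1) * (revProd r t * x) := by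
  rw [revProd, mul_assoc]

theorem exists_mkReflection_of_forall_adjacentParallel (hE : Module.finrank ℝ E = 2)
    (hΦ : IsRootSystem Φ) {n : ℕ} {r : ℕ → affineWeylGroup Φ} {α : E} (hα : α ∈ Φ)
    (h1 : ∃ a, r 1 = mkReflection hα a) (hr : ∀ t, 1 ≤ t → t ≤ n → IsReflection Φ (r t))
    (hadj : ∀ t, 1 ≤ t → t < n → AdjacentParallel Φ (r t) (r (t + 1))) {t : ℕ} (ht : 1 ≤ t)
    (htn : t ≤ n) : ∃ a, r t = mkReflection hα a := by
  induction t, ht using Nat.le_induction with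
  | base => exact h1
  | succ t ht ih =>
    obtain ⟨a, ha⟩ := ih (by omega)
    have := hadj t ht (by omega)
    rw [ha] at this
    obtain ⟨b, hb, -⟩ := this.exists_mkReflection hE hΦ hα (hr _ (by omega) htn)
    exact ⟨b, hb⟩

/-- If a reflection raises the length of `u` by one and does not map `u` to `u * s`, then it also
raises the length of a longer neighbour `u * s` by one. -/
theorem length_mkReflection_mul_mul_simpleReflection (hE : Module.finrank ℝ E = 2)
    (hΦ : IsRootSystem Φ) {p : E} (hp : p ∈ regularPoints Φ) {u s : affineWeylGroup Φ}
    (hs : s ∈ simpleReflections Φ (alcove Φ p)) {δ : E} (hδ : δ ∈ Φ) {k : ℤ}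
    (hus : length (simpleReflections Φ (alcove Φ p)) (u * s)
      = length (simpleReflections Φ (alcove Φ p)) u + 1)
    (hu : length (simpleReflections Φ (alcove Φ p)) (mkReflection hδ k * u)
      = length (simpleReflections Φ (alcove Φ p)) u + 1)
    (hne : mkReflection hδ k * u ≠ u * s) :
    length (simpleReflections Φ (alcove Φ p)) (mkReflection hδ k * (u * s))
      = length (simpleReflections Φ (alcove Φ p)) (u * s) + 1 := by
  have h1 := not_separates_of_length_lt hE hΦ hp hδ (k := k) (x := u) (by omega)
  have h2 : ¬ Separates δ k (u.1 p) ((u * s : affineWeylGroup Φ).1 p) := by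
    intro h
    apply hne
    rw [mkReflection_eq_of_separates hE hΦ hp hs hδ h]
    group
  have h3 := length_mkReflection_mul hE hΦ hp hδ (x := u * s)
    (fun h => h2 ((separates_trans_iff h1).1 h))
  have h4 := length_mul_le (S := simpleReflections Φ (alcove Φ p))
    (fun _ => inv_of_mem_simpleReflections)
    (mem_closure_simpleReflections hE hΦ hp (mkReflection hδ k * u)) hs
  rw [mul_assoc] at h4
  omega

theorem mul_mul_self_of_mem_simpleReflections {C : Set E} {s : affineWeylGroup Φ}
    (hs : s ∈ simpleReflections Φ C) (x : affineWeylGroup Φ) : x * s * s = x := by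
  nth_rewrite 2 [← inv_of_mem_simpleReflections hs]
  group

theorem not_bruhatLE_revProd (hE : Module.finrank ℝ E = 2) (hΦ : IsRootSystem Φ) {p : E}
    (hp : p ∈ regularPoints Φ) {w s : affineWeylGroup Φ}
    (hs : s ∈ simpleReflections Φ (alcove Φ p))
    (hws : length (simpleReflections Φ (alcove Φ p)) (w * s)
      < length (simpleReflections Φ (alcove Φ p)) w)
    {n : ℕ} (hn : 1 ≤ n) {r : ℕ → affineWeylGroup Φ}
    (hr : ∀ t, 1 ≤ t → t ≤ n → IsReflection Φ (r t))
    (hadj : ∀ t, 1 ≤ t → t < n → AdjacentParallel Φ (r t) (r (t + 1)))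
    (hlen : ∀ t < n, length (simpleReflections Φ (alcove Φ p)) (r (t + 1) * (revProd r t * w * s))
      = length (simpleReflections Φ (alcove Φ p)) (revProd r t * w * s) + 1)
    (hne : ∀ t < n, r (t + 1) * (revProd r t * w * s) ≠ revProd r t * w)
    (hbetween : ∀ q : affineWeylGroup Φ, IsReflection Φ q →
      (wall Φ q).Parallel (wall Φ (r 1)) →
      ¬ WallBetween Φ q (w.1 '' alcove Φ p) (wall Φ (r 1))) :
    ¬ BruhatLE Φ p w (revProd r n * w * s) := by
  intro hle
  set S := simpleReflections Φ (alcove Φ p) with hS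
  have hss := mul_mul_self_of_mem_simpleReflections hs
  have hu : ∀ t, revProd r (t + 1) * w * s = r (t + 1) * (revProd r t * w * s) := by
    intro t
    rw [revProd]
    group
  have hv : ∀ t, revProd r (t + 1) * w = r (t + 1) * (revProd r t * w) :=
    fun t => revProd_succ_mul r t w
  have hu0 : revProd r 0 * w * s = w * s := by rw [revProd, one_mul]
  have hv0 : revProd r 0 * w = w := by rw [revProd, one_mul]
  have hw1 : length S w = length S (w * s) + 1 := by
    have := length_mul_le (S := S) (fun _ => inv_of_mem_simpleReflections)
      (mem_closure_simpleReflections hE hΦ hp (w * s)) hs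
    rw [hss] at this
    omega
  have hlu : ∀ t ≤ n, length S (revProd r t * w * s) = length S (w * s) + t := by
    intro t ht
    induction t with
    | zero => rw [hu0, add_zero]
    | succ t ih =>
      rw [hu, hlen t (by omega), ih (by omega)]
      ring
  have hlv : ∀ t ≤ n, length S (revProd r t * w) = length S (revProd r t * w * s) + 1 := by
    intro t ht
    induction t with
    | zero => rw [hu0, hv0, hw1]
    | succ t ih =>
      obtain ⟨δ, hδ, k, hk⟩ := isReflection_iff.1 (hr (t + 1) (by omega) ht)
      have h1 := hlen t (by omega)
      have h2 := hne t (by omega)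
      have h3 := ih (by omega)
      rw [hu, hv, h1, ← h3]
      rw [hk] at h1 h2 ⊢
      have := length_mkReflection_mul_mul_simpleReflection hE hΦ hp hs hδ
        (u := revProd r t * w * s) (by rw [hss]; exact h3) h1 (by rw [hss]; exact h2)
      rwa [hss] at this
  have hlr : ∀ t < n, length S (r (t + 1) * (revProd r t * w))
      = length S (revProd r t * w) + 1 := by
    intro t ht
    rw [← hv, hlv _ ht, hlv _ ht.le, hlu _ ht, hlu _ ht.le, Nat.succ_eq_add_one, ← add_assoc]
  obtain ⟨α, hα, a₁, ha₁⟩ := isReflection_iff.1 (hr 1 le_rfl hn)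
  have hex : ∀ t, 1 ≤ t → t ≤ n → ∃ a, r t = mkReflection hα a := fun t ht htn =>
    exists_mkReflection_of_forall_adjacentParallel hE hΦ hα ⟨a₁, ha₁⟩ hr hadj ht htn
  have hlen1 := hlen 0 hn
  have hne1 := hne 0 hn
  rw [hu0, zero_add] at hlen1
  rw [hu0, hv0, zero_add] at hne1
  -- the wall between `w * s` and `w` is not parallel to the walls of the `r t`
  have hnpar : ∀ j, w * s * w⁻¹ ≠ mkReflection hα j := by
    intro j hj
    have hjw : mkReflection hα j * (w * s) = w := by
      rw [← hj]
      calc w * s * w⁻¹ * (w * s) = w * s * s := by group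
        _ = w := hss w
    have hwr := smul_mem_regularPoints hΦ w hp
    have hwsr := smul_mem_regularPoints hΦ (w * s) hp
    have hlev := level_self_mkReflection hΦ hα j hwsr
    rw [← coe_mkReflection hα, ← coe_mul_apply, hjw] at hlev
    rcases lt_trichotomy (level α ((w * s : affineWeylGroup Φ).1 p)) (level α (w.1 p))
      with h | h | h
    · rw [ha₁] at hlen1 hne1 hbetween
      exact length_ne_of_parallel hE hΦ hp hs hw1 hα h hne1 hbetween hlen1
    · omega
    · rw [ha₁, ← mkReflection_neg hΦ hα] at hlen1 hne1 hbetween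
      refine length_ne_of_parallel hE hΦ hp hs hw1 (hΦ.neg_mem hα) ?_ hne1 hbetween hlen1
      rw [level_neg hwr hα, level_neg hwsr hα]
      omega
  have hnpar' : ∀ t ≤ n, ∀ j, revProd r t * w * s * s * (revProd r t * w * s)⁻¹
      ≠ mkReflection hα j := by
    intro t ht
    induction t with
    | zero =>
      intro j hj
      apply hnpar j
      rw [hu0] at hj
      rw [← mkReflection_inv hα, ← hj, hss]
      group
    | succ t ih =>
      intro j hj
      obtain ⟨a, ha⟩ := hex (t + 1) (by omega) ht
      apply ih (by omega) (2 * a - j)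
      rw [← conj_mkReflection_self hΦ hα, ← hj, hu, ha]
      have h := mkReflection_mul_self hα a
      generalize mkReflection hα a = q at h
      calc _ = q * q * (revProd r t * w * s * s * (revProd r t * w * s)⁻¹) * (q * q)⁻¹ := by
            rw [h]; group
        _ = _ := by group
  have hlev : ∀ t ≤ n, (t : ℤ) ≤ |level α ((revProd r t * w).1 p) - level α p| := by
    intro t ht
    induction t with
    | zero => simp
    | succ t ih =>
      obtain ⟨a, ha⟩ := hex (t + 1) (by omega) ht
      have h1 := hlr t ht
      rw [ha] at h1
      have h2 := (length_mkReflection_mul_eq hE hΦ hp hα h1).1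
      have h3 := ih (by omega)
      rw [hv, ha, h2]
      push_cast
      exact add_le_add_left h3 1
  have hinner : ∀ t ≤ n, ∀ v : E, (inner ℝ v α : ℝ) = 0 →
      (inner ℝ (w.1 p) v : ℝ) = inner ℝ ((revProd r t * w).1 p) v := by
    intro t ht v hvα
    induction t with
    | zero => rw [hv0]
    | succ t ih =>
      obtain ⟨a, ha⟩ := hex (t + 1) (by omega) ht
      rw [hv, ha, coe_mul_apply, coe_mkReflection, inner_affineReflection_of_orthogonal hvα]
      exact ih (by omega)
  have hsector : 3 ≤ n → ∀ δ : E, ∀ hδ : δ ∈ Φ,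
      (∀ t, 1 ≤ t → t ≤ n → ∃ a, r t = mkReflection hδ a) →
      (∀ j, revProd r n * w * s * s * (revProd r n * w * s)⁻¹ ≠ mkReflection hδ j) →
      (∀ v : E, (inner ℝ v δ : ℝ) = 0 →
        (inner ℝ (w.1 p) v : ℝ) = inner ℝ ((revProd r n * w).1 p) v) →
      level δ p + 3 ≤ level δ ((revProd r n * w).1 p) → False := by
    intro h3n δ hδ hex hnpar hinner hD
    obtain ⟨m, rfl⟩ : ∃ m, n = m + 2 := ⟨n - 2, by omega⟩
    obtain ⟨a, ha⟩ := hex (m + 1) (by omega) (by omega)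
    have hadj' := hadj (m + 1) (by omega) (by omega)
    rw [ha] at hadj'
    obtain ⟨b, hb, hab⟩ := hadj'.exists_mkReflection hE hΦ hδ (hr _ (by omega) le_rfl)
    have h1 := hlr m (by omega)
    have h2 := hlr (m + 1) (by omega)
    rw [ha] at h1
    rw [hv m, ha, hb] at h2
    have hvm : revProd r (m + 2) * w
        = mkReflection hδ b * (mkReflection hδ a * (revProd r m * w)) := by
      rw [hv (m + 1), hv m, ha, hb]
    obtain ⟨β, hβ, hlevβ⟩ := exists_isSimplePair_level_le hE hΦ hp hδ hab h1 h2
      (by rw [← hvm]; exact hD)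
    rw [← hvm] at hlevβ
    refine not_bruhatLE_of_sector hE hΦ hp hβ hs ?_ hnpar ?_ ?_ ?_ hle
    · rw [hss]
      exact hlv _ le_rfl
    · rwa [hss]
    · rwa [hss]
    · rwa [hss]
  have hbig : ¬ 3 ≤ n := by
    intro h3n
    have h1 := hlev n le_rfl
    have hvr := smul_mem_regularPoints hΦ (revProd r n * w) hp
    rcases le_total 0 (level α ((revProd r n * w).1 p) - level α p) with h | h
    · rw [abs_of_nonneg h] at h1
      exact hsector h3n α hα hex (hnpar' n le_rfl) (hinner n le_rfl) (by omega)
    · rw [abs_of_nonpos h] at h1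
      refine hsector h3n (-α) (hΦ.neg_mem hα) (fun t h1 h2 => ?_) (fun j hj => ?_)
        (fun v hvα => hinner n le_rfl v (by simpa using hvα)) ?_
      · obtain ⟨a, ha⟩ := hex t h1 h2
        exact ⟨-a, by rw [ha, mkReflection_neg hΦ hα]⟩
      · apply hnpar' n le_rfl (-j)
        rw [hj, ← mkReflection_neg hΦ hα, neg_neg]
      · rw [level_neg hp hα, level_neg hvr hα]
        omega
  obtain rfl | rfl : n = 1 ∨ n = 2 := by omega
  · have h1 := hlu 1 le_rfl
    rcases BruhatLE.eq_or_length_lt hE hΦ hp hle with h | h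
    · rw [hu, hu0] at h
      exact hne1 h.symm
    · rw [← hS] at h
      omega
  · have h2 := hlu 2 le_rfl
    rcases hle.cases_head with h | ⟨z, ⟨δ, hδ, l, rfl, hsep⟩, hz⟩
    · rw [← h] at h2
      omega
    · have h3 := length_mkReflection_mul hE hΦ hp hδ hsep
      rcases BruhatLE.eq_or_length_lt hE hΦ hp hz with h | h
      · obtain ⟨b, hb⟩ := hex 2 (by omega) le_rfl
        obtain ⟨γ, hγ, k, hk, -⟩ := exists_wall_smul hE hΦ hp hs w
        have hab : a₁ ≠ b := by
          rintro rfl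
          refine (hadj 1 le_rfl (by omega)).2.1 ?_
          rw [ha₁, hb]
        have hglide : mkReflection hα b * mkReflection hα a₁ * mkReflection hγ k
            = mkReflection hδ l := by
          rw [← hk, ← ha₁, ← hb]
          rw [hu, hu, hu0, ← eq_mul_inv_iff_mul_eq] at h
          rw [h]
          group
        rcases eq_or_eq_neg_of_glide hΦ hα hγ hδ hab hglide with rfl | rfl
        · exact hnpar k hk
        · exact hnpar (-k) (by rw [hk, ← mkReflection_neg hΦ hγ])
      · rw [← hS] at h h3
        omega

end Annex

end AffineCoxeter

end

theorem theorem1p4 {E : Type*} [NormedAddCommGroup E] [InnerProductSpace ℝ E]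
    (hE : Module.finrank ℝ E = 2)
    (Φ : Set E) (hΦ : AffineCoxeter.IsRootSystem Φ)
    (C : Set E) (hC : AffineCoxeter.IsAlcove Φ C)
    (S : Set (AffineCoxeter.affineWeylGroup Φ)) (hS : S = AffineCoxeter.simpleReflections Φ C)
    (w s : AffineCoxeter.affineWeylGroup Φ) (hs : s ∈ S)
    (hws : AffineCoxeter.length S (w * s) < AffineCoxeter.length S w)
    (n : ℕ) (hn : 1 ≤ n) (r : ℕ → AffineCoxeter.affineWeylGroup Φ)
    (hr : ∀ t, 1 ≤ t → t ≤ n → AffineCoxeter.IsReflection Φ (r t))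
    (hadj : ∀ t, 1 ≤ t → t < n → AffineCoxeter.AdjacentParallel Φ (r t) (r (t + 1)))
    (hlen : ∀ t, 1 ≤ t → t ≤ n →
      AffineCoxeter.length S (AffineCoxeter.revProd r t * w * s) =
        AffineCoxeter.length S (AffineCoxeter.revProd r (t - 1) * w * s) + 1)
    (hne : ∀ t, 1 ≤ t → t ≤ n →
      AffineCoxeter.revProd r t * w * s ≠ AffineCoxeter.revProd r (t - 1) * w)
    (hbetween : ∀ q : AffineCoxeter.affineWeylGroup Φ, AffineCoxeter.IsReflection Φ q →
      (AffineCoxeter.wall Φ q).Parallel (AffineCoxeter.wall Φ (r 1)) →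
      ¬ AffineCoxeter.WallBetween Φ q ((w : Equiv.Perm E) '' C)
          (AffineCoxeter.wall Φ (r 1))) :
    AffineCoxeter.revProd r n * w * s ∈ AffineCoxeter.annex S w := by
  obtain ⟨p, hp, rfl⟩ := hC
  rw [AffineCoxeter.connectedComponentIn_eq_alcove hΦ hp] at hS hbetween
  subst hS
  have hrev : ∀ t, AffineCoxeter.revProd r (t + 1) * w * s
      = r (t + 1) * (AffineCoxeter.revProd r t * w * s) := by
    intro t
    rw [mul_assoc, AffineCoxeter.revProd_succ_mul, mul_assoc]
  refine fun hmem => AffineCoxeter.not_bruhatLE_revProd hE hΦ hp hs hws hn hr hadj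
    (fun t ht => ?_) (fun t ht => ?_) hbetween (AffineCoxeter.bruhatLE_of_mem_shadow hE hΦ hp hmem)
  · have := hlen (t + 1) (by omega) ht
    rwa [hrev, Nat.add_sub_cancel] at this
  · have := hne (t + 1) (by omega) ht
    rwa [hrev, Nat.add_sub_cancel] at this
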